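/- Let $A$ and $B$ be finite-dimensional complex Hilbert spaces. Write $\mathrm{L}(A)$ for the linear operators on $A$, and $\mathrm{supp}(H)$ for the support of a self-adjoint operator $H$. All functions of self-adjoint operators are taken by the spectral calculus, with logarithms and negative powers taken on the support. For a self-adjoint operator $H$ with spectral decomposition $H=\sum_{k=1}^{d}\lambda_k P_k$ (the $\lambda_k$ being the distinct eigenvalues, $P_k$ the eigenprojectors) and $\vartheta\in[0,2\pi]^{d}$, let $U_H^{\vartheta}=\sum_{k}e^{i\vartheta_k}P_k$. For non-negative operators $\rho,\sigma$ let - $D(\rho\|\sigma)=\mathrm{tr}\,\rho(\log\rho-\log\sigma)$ if $\mathrm{supp}(\rho)\subseteq\mathrm{supp}(\sigma)$, and $+\infty$ otherwise (the relative entropy); - $D_{\mathbb M}(\rho\|\sigma)=\sup_{\{M_x\}} D\bigl(\sum_x\mathrm{tr}(\rho M_x)|x\rangle\langle x|\,\big\|\,\sum_x\mathrm{tr}(\sigma M_x)|x\rangle\langle x|\bigr)$, the supremum being over all finite projective measurements, i.e. finite families of orthogonal projectors $M_x$ with $\sum_x M_x=\mathrm{id}$ (the measured relative entropy); - $F(\rho,\sigma)=\|\sqrt\rho\sqrt\sigma\|_1$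 (the fidelity). A linear map $\mathcal N:\mathrm{L}(A)\to\mathrm{L}(B)$ is tensor-stable positive if $\mathcal N^{\otimes n}$ maps non-negative operators to non-negative operators for every $n\in\mathbb N$; $\mathcal N^\dagger$ denotes its adjoint for the Hilbert–Schmidt inner product. For a non-negative operator $\sigma$ on $A$, let $d_1$ and $d_2$ be the numbers of distinct eigenvalues of $\sigma$ and of $\mathcal N(\sigma)$. The doubly rotated Petz maps are, for $\vartheta\in[0,2\pi]^{d_1}$ and $\varphi\in[0,2\pi]^{d_2}$, $$\mathcal T^{\varphi,\vartheta}_{\sigma,\mathcal N}(X)=U_\sigma^{\vartheta}\,\sigma^{1/2}\,\mathcal N^\dagger\Bigl(\mathcal N(\sigma)^{-1/2}\,U_{\mathcal N(\sigma)}^{\varphi}\,X\,\bigl(U_{\mathcal N(\sigma)}^{\varphi}\bigr)^\dagger\,\mathcal N(\sigma)^{-1/2}\Bigr)\,\sigma^{1/2}\,\bigl(U_\sigma^{\vartheta}\bigr)^\dagger ,$$ and $\mathrm T_{\sigma,\mathcal N}$ denotes the convex hull of all of them. **Theorem.** Let $\sigma$ be a non-negative operator on $A$, let $\rho$ be a density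 operator on $A$ with $\mathrm{supp}(\rho)\subseteq\mathrm{supp}(\sigma)$, and let $\mathcal N:\mathrm L(A)\to\mathrm L(B)$ be a trace-preserving, tensor-stable positive linear map. Then there exists $\mathcal R\in\mathrm T_{\sigma,\mathcal N}$ (which may depend on $\sigma$, $\mathcal N$ and $\rho$) such that $$D(\rho\|\sigma)-D\bigl(\mathcal N(\rho)\big\|\mathcal N(\sigma)\bigr)\;\ge\;D_{\mathbb M}\bigl(\rho\,\big\|\,(\mathcal R\circ\mathcal N)(\rho)\bigr)\;\ge\;-2\log F\bigl(\rho,(\mathcal R\circ\mathcal N)(\rho)\bigr),$$ and moreover $(\mathcal R\circ\mathcal N)(\sigma)=\sigma$. -/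

import Mathlib

open scoped Matrix ComplexOrder

noncomputable section

namespace PetzRecovery

/-- A density operator: a positive semidefinite matrix of trace one. -/
def IsDensity {a : Type*} [Fintype a] (ρ : Matrix a a ℂ) : Prop :=
  ρ.PosSemidef ∧ ρ.trace = 1

/-- The support of a self-adjoint operator, i.e. the orthogonal complement of its kernel, which is
its range. -/
def supp {a : Type*} [Fintype a] (H : Matrix a a ℂ) : Submodule ℂ (a → ℂ) :=
  LinearMap.range H.mulVecLin

/-! ### Linear maps on operators -/

/-- The map sends non-negative operators to non-negative operators. -/
def IsPositiveMap {a b : Type*} (N : Matrix a a ℂ →ₗ[ℂ] Matrix b b ℂ) : Prop :=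
  ∀ X : Matrix a a ℂ, X.PosSemidef → (N X).PosSemidef

def IsTracePreserving {a b : Type*} [Fintype a] [Fintype b]
    (N : Matrix a a ℂ →ₗ[ℂ] Matrix b b ℂ) : Prop :=
  ∀ X : Matrix a a ℂ, (N X).trace = X.trace

/-- The product operator `X₁ ⊗ ⋯ ⊗ Xₙ` on the `n`-fold tensor power, whose product basis is
indexed by `Fin n → a`. -/
def tensorProd {a : Type*} {n : ℕ} (X : Fin n → Matrix a a ℂ) :
    Matrix (Fin n → a) (Fin n → a) ℂ :=
  Matrix.of fun k l => ∏ m, X m (k m) (l m)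

/-- The `n`-fold tensor power `N^{⊗ n}` of a linear map on operators: the linear map which sends
the matrix unit `E_{k l} = E_{k₁ l₁} ⊗ ⋯ ⊗ E_{kₙ lₙ}` to `N(E_{k₁ l₁}) ⊗ ⋯ ⊗ N(E_{kₙ lₙ})`. -/
def tensorPower {a b : Type*} [Fintype a] [DecidableEq a] (n : ℕ)
    (N : Matrix a a ℂ →ₗ[ℂ] Matrix b b ℂ) :
    Matrix (Fin n → a) (Fin n → a) ℂ →ₗ[ℂ] Matrix (Fin n → b) (Fin n → b) ℂ where
  toFun X := ∑ k, ∑ l, X k l • tensorProd fun m => N (Matrix.single (k m) (l m) 1)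
  map_add' X Y := by
    simp only [Matrix.add_apply, add_smul, Finset.sum_add_distrib]
  map_smul' c X := by
    simp only [Matrix.smul_apply, smul_eq_mul, mul_smul, Finset.smul_sum, RingHom.id_apply]

/-- `N^{⊗ n}` is positive for every `n`. -/
def IsTensorStablePositive {a b : Type*} [Fintype a] [DecidableEq a]
    (N : Matrix a a ℂ →ₗ[ℂ] Matrix b b ℂ) : Prop :=
  ∀ n : ℕ, IsPositiveMap (tensorPower n N)

/-- The adjoint `N†` of `N` for the Hilbert–Schmidt inner product `⟨X, Y⟩ = tr (Xᴴ Y)`. Its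
`(i, j)` entry is `⟨E_{i j}, N† Y⟩ = ⟨N E_{i j}, Y⟩`. -/
def hsAdjoint {a b : Type*} [DecidableEq a] [Fintype b]
    (N : Matrix a a ℂ →ₗ[ℂ] Matrix b b ℂ) : Matrix b b ℂ →ₗ[ℂ] Matrix a a ℂ where
  toFun Y := Matrix.of fun i j => ((N (Matrix.single i j 1))ᴴ * Y).trace
  map_add' X Y := by
    ext i j
    simp [Matrix.mul_add]
  map_smul' c X := by
    ext i j
    simp

/-! ### Functions of a self-adjoint operator

All functions are applied through the spectral calculus; `Real.log 0 = 0` and `0⁻¹ = 0` give the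
usual conventions that logarithms and negative powers are taken on the support. -/

def opLog {a : Type*} [Fintype a] [DecidableEq a] (H : Matrix a a ℂ) : Matrix a a ℂ :=
  cfc Real.log H

def opSqrt {a : Type*} [Fintype a] [DecidableEq a] (H : Matrix a a ℂ) : Matrix a a ℂ :=
  cfc Real.sqrt H

/-- `H ^ (-1/2)`, the inverse being taken on the support of `H`. -/
def opInvSqrt {a : Type*} [Fintype a] [DecidableEq a] (H : Matrix a a ℂ) : Matrix a a ℂ :=
  cfc (fun x : ℝ => (Real.sqrt x)⁻¹) H

/-- The projector onto the eigenspace of the self-adjoint operator `H` for the eigenvalue `x`. -/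
def eigenProj {a : Type*} [Fintype a] [DecidableEq a] (H : Matrix a a ℂ) (x : ℝ) :
    Matrix a a ℂ :=
  cfc (fun y : ℝ => if y = x then 1 else 0) H

/-- The unitary `U_H^θ = ∑ₖ exp(i θₖ) Pₖ`, where `k` runs over the distinct eigenvalues of `H`. -/
def rotation {a : Type*} [Fintype a] [DecidableEq a] (H : Matrix a a ℂ)
    (θ : spectrum ℝ H → ℝ) : Matrix a a ℂ :=
  ∑ᶠ k : spectrum ℝ H, Complex.exp (Complex.I * (θ k : ℂ)) • eigenProj H (k : ℝ)

/-! ### Entropic quantities -/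

open Classical in
/-- The relative entropy `D(ρ‖σ) = tr (ρ (log ρ - log σ))` if `supp ρ ⊆ supp σ`, and `+∞`
otherwise. -/
def relEntropy {a : Type*} [Fintype a] [DecidableEq a] (ρ σ : Matrix a a ℂ) : EReal :=
  if supp ρ ≤ supp σ then (((ρ * (opLog ρ - opLog σ)).trace.re : ℝ) : EReal) else ⊤

/-- A projective measurement with `n` outcomes. -/
def IsProjMeasurement {a : Type*} [Fintype a] [DecidableEq a] {n : ℕ}
    (M : Fin n → Matrix a a ℂ) : Prop :=
  (∀ x, (M x).IsHermitian ∧ M x * M x = M x) ∧ ∑ x, M x = 1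

/-- The measurement map `ρ ↦ ∑ₓ tr (ρ Mₓ) |x⟩⟨x|`. -/
def measure {a : Type*} [Fintype a] {n : ℕ} (M : Fin n → Matrix a a ℂ) (ρ : Matrix a a ℂ) :
    Matrix (Fin n) (Fin n) ℂ :=
  Matrix.diagonal fun x => (ρ * M x).trace

/-- The measured relative entropy: the supremum over all projective measurements of the relative
entropy of the measurement outcomes. -/
def measuredRelEntropy {a : Type*} [Fintype a] [DecidableEq a] (ρ σ : Matrix a a ℂ) : EReal :=
  ⨆ (n : ℕ) (M : Fin n → Matrix a a ℂ) (_ : IsProjMeasurement M),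
    relEntropy (measure M ρ) (measure M σ)

/-- The trace norm `‖A‖₁ = tr √(Aᴴ A)`. -/
def traceNorm {a : Type*} [Fintype a] [DecidableEq a] (A : Matrix a a ℂ) : ℝ :=
  (opSqrt (Aᴴ * A)).trace.re

/-- The fidelity `F(ρ, σ) = ‖√ρ √σ‖₁`. -/
def fidelity {a : Type*} [Fintype a] [DecidableEq a] (ρ σ : Matrix a a ℂ) : ℝ :=
  traceNorm (opSqrt ρ * opSqrt σ)

/-! ### Rotated Petz recovery maps -/

/-- `X ↦ A * X * Aᴴ`. -/
def conjMap {a : Type*} [Fintype a] (A : Matrix a a ℂ) : Matrix a a ℂ →ₗ[ℂ] Matrix a a ℂ where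
  toFun X := A * X * Aᴴ
  map_add' X Y := by rw [Matrix.mul_add, Matrix.add_mul]
  map_smul' c X := by simp

/-- `X ↦ A * X * A`. -/
def sandwich {a : Type*} [Fintype a] (A : Matrix a a ℂ) : Matrix a a ℂ →ₗ[ℂ] Matrix a a ℂ where
  toFun X := A * X * A
  map_add' X Y := by rw [Matrix.mul_add, Matrix.add_mul]
  map_smul' c X := by simp

/-- The doubly rotated Petz recovery map
`X ↦ U_σ^θ σ^{1/2} N†(N(σ)^{-1/2} U_{N(σ)}^φ X (U_{N(σ)}^φ)ᴴ N(σ)^{-1/2}) σ^{1/2} (U_σ^θ)ᴴ`. -/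
def rotatedPetz {a b : Type*} [Fintype a] [DecidableEq a] [Fintype b] [DecidableEq b]
    (σ : Matrix a a ℂ) (N : Matrix a a ℂ →ₗ[ℂ] Matrix b b ℂ)
    (φ : spectrum ℝ (N σ) → ℝ) (θ : spectrum ℝ σ → ℝ) :
    Matrix b b ℂ →ₗ[ℂ] Matrix a a ℂ :=
  conjMap (rotation σ θ) ∘ₗ sandwich (opSqrt σ) ∘ₗ hsAdjoint N ∘ₗ
    sandwich (opInvSqrt (N σ)) ∘ₗ conjMap (rotation (N σ) φ)

/-- The convex hull of all doubly rotated Petz recovery maps. -/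
def rotatedPetzHull {a b : Type*} [Fintype a] [DecidableEq a] [Fintype b] [DecidableEq b]
    (σ : Matrix a a ℂ) (N : Matrix a a ℂ →ₗ[ℂ] Matrix b b ℂ) :
    Set (Matrix b b ℂ →ₗ[ℂ] Matrix a a ℂ) :=
  convexHull ℝ {T | ∃ (φ : spectrum ℝ (N σ) → ℝ) (θ : spectrum ℝ σ → ℝ),
    (∀ k, φ k ∈ Set.Icc 0 (2 * Real.pi)) ∧ (∀ k, θ k ∈ Set.Icc 0 (2 * Real.pi)) ∧
      T = rotatedPetz σ N φ θ}

end PetzRecovery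

end

open PetzRecovery

section
open scoped MatrixOrder Matrix.Norms.L2Operator
open Matrix

set_option linter.unusedSectionVars false

namespace PetzRecovery

variable {a b : Type*} [Fintype a] [DecidableEq a] [Fintype b] [DecidableEq b] {n : ℕ}

/-! ### Real trace -/

/-! Write c = D(ρ‖σ) − D(Nρ‖Nσ). The core is a bound valid for every positive definite test operator
H: exp(tr ρ log H − c) is at most the supremum over the angles of tr(H T(Nρ)), T running over the
doubly rotated Petz maps (`exp_retr_log_sub_le`). If everything commuted, this would follow from
Jensen and Gibbs.

Commutation is forced asymptotically, in tensor powers (`exp_retr_log_le`). The powers of H and of a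
regularised Nρ are replaced by their twirls over the rotations of σ and N(σ). A twirl dominates the
original operator (`le_twirl`), commutes with the tensor powers of functions of σ, respectively N(σ)
(`twirl_commute`), and has only polynomially many terms in n. Logarithms of the products then add
exactly. Operator monotonicity of the logarithm, the operator Jensen inequality for the adjoint of
N^{⊗n} (here tensor-stable positivity enters) and Golden–Thompson in variational form bound the n-th
power of the exponential by the trace of a product; expanding the twirls turns that trace into a sum
of n-th powers of tr(H T(·)) (`sum_retr_pow`). The polynomial factor disappears on taking n-th
roots. Golden–Thompson is itself obtained by this device from Klein's inequality.

Kernels are handled by giving σ and N(σ) the eigenvalue r² in place of 0 and letting r tend to 0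
(`petzMap_regularized_le`).

To choose one map for all H, the exponential is linearised by 1 + x ≤ exp x. The bound becomes tr ρ
log H − c + 1 ≤ tr(H X), concave in H on the left and linear in X on the right, with X in a compact
convex set of recovered operators; separation of convex sets provides a common X = R(Nρ)
(`exists_mem_rotatedPetzHull`).

For a measurement M, testing with H = ∑ y_x M_x and optimising over y gives D_M ≤ c
(`measuredRelEntropy_le`). The fidelity bound comes from measuring in the eigenbasis of the
Fuchs–Caves operator, for which tr ρH⁻¹ and tr ωH both equal the fidelity (`sqrtFidelity_bound`).
Finally, every rotated Petz map sends N(σ) to σ, and this condition passes to convex combinations.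
-/

/-- The real part of the trace, as a real-linear functional. -/
noncomputable def retr : Matrix a a ℂ →ₗ[ℝ] ℝ :=
  Complex.reLm ∘ₗ (Matrix.traceLinearMap a ℝ ℂ)

lemma retr_apply (X : Matrix a a ℂ) : retr X = X.trace.re := rfl

lemma retr_mul_comm (X Y : Matrix a a ℂ) : retr (X * Y) = retr (Y * X) := by
  rw [retr_apply, retr_apply, trace_mul_comm]

lemma retr_nonneg {X : Matrix a a ℂ} (hX : 0 ≤ X) : 0 ≤ retr X :=
  (Complex.le_def.1 hX.posSemidef.trace_nonneg).1

lemma trace_eq_retr {X : Matrix a a ℂ} (hX : X.IsHermitian) : X.trace = (retr X : ℂ) := by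
  refine Complex.ext rfl ?_
  have h : star X.trace = X.trace := by rw [← trace_conjTranspose, hX.eq]
  simpa using Complex.conj_eq_iff_im.1 h

lemma trace_mul_eq_retr {X Y : Matrix a a ℂ} (hX : X.IsHermitian) (hY : Y.IsHermitian) :
    (X * Y).trace = (retr (X * Y) : ℂ) := by
  refine Complex.ext rfl ?_
  have h : star (X * Y).trace = (X * Y).trace := by
    rw [← trace_conjTranspose, conjTranspose_mul, hX.eq, hY.eq, trace_mul_comm]
  simpa using Complex.conj_eq_iff_im.1 h

lemma retr_mul_nonneg {X Y : Matrix a a ℂ} (hX : 0 ≤ X) (hY : 0 ≤ Y) : 0 ≤ retr (X * Y) := by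
  obtain ⟨B, rfl⟩ := CStarAlgebra.nonneg_iff_eq_star_mul_self.mp hX
  rw [retr_mul_comm, ← mul_assoc, retr_mul_comm, ← mul_assoc]
  exact retr_nonneg (by
    simpa [star_eq_conjTranspose] using (hY.posSemidef.mul_mul_conjTranspose_same B).nonneg)

lemma retr_mul_le_mul_left {A X Y : Matrix a a ℂ} (hA : 0 ≤ A) (h : X ≤ Y) :
    retr (A * X) ≤ retr (A * Y) := by
  have := retr_mul_nonneg hA (sub_nonneg.2 h)
  rw [mul_sub, map_sub] at this
  linarith

lemma retr_mul_le_mul_right {A X Y : Matrix a a ℂ} (hA : 0 ≤ A) (h : X ≤ Y) :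
    retr (X * A) ≤ retr (Y * A) := by
  rw [retr_mul_comm X, retr_mul_comm Y]
  exact retr_mul_le_mul_left hA h

lemma retr_mono {X Y : Matrix a a ℂ} (h : X ≤ Y) : retr X ≤ retr Y := by
  have := retr_nonneg (sub_nonneg.2 h)
  rw [map_sub] at this
  linarith

lemma eq_zero_of_retr_eq_zero {X : Matrix a a ℂ} (hX : 0 ≤ X) (h : retr X = 0) : X = 0 := by
  rw [← hX.posSemidef.trace_eq_zero_iff, trace_eq_retr hX.posSemidef.1, h]
  rfl

/-- With X = B*B and Y = C*C, C invertible, the trace is the squared Hilbert–Schmidt norm of CB*,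
which vanishes only for B = 0. -/
lemma retr_mul_pos {X Y : Matrix a a ℂ} (hX : 0 ≤ X) (hX0 : X ≠ 0) (hY : Y.PosDef) :
    0 < retr (X * Y) := by
  refine (retr_mul_nonneg hX hY.posSemidef.nonneg).lt_of_ne' fun h => hX0 ?_
  obtain ⟨B, rfl⟩ := CStarAlgebra.nonneg_iff_eq_star_mul_self.mp hX
  obtain ⟨C, hC, rfl⟩ := CStarAlgebra.isStrictlyPositive_iff_eq_star_mul_self.mp
    hY.isStrictlyPositive
  have h1 : retr ((C * star B)ᴴ * (C * star B)) = 0 := by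
    rw [← h]
    rw [← star_eq_conjTranspose, star_mul, star_star, mul_assoc, retr_mul_comm]
    simp only [mul_assoc]
    rw [← mul_assoc, retr_mul_comm]
    simp only [mul_assoc]
  have h2 := eq_zero_of_retr_eq_zero (posSemidef_conjTranspose_mul_self _).nonneg h1
  rw [conjTranspose_mul_self_eq_zero] at h2
  have h3 : star B = 0 := by
    lift C to (Matrix a a ℂ)ˣ using hC
    simpa [← mul_assoc] using congr(((C⁻¹ : (Matrix a a ℂ)ˣ) : Matrix a a ℂ) * $h2)
  simp [h3]

lemma conj_mono {X Y : Matrix a a ℂ} (h : X ≤ Y) (A : Matrix b a ℂ) :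
    A * X * Aᴴ ≤ A * Y * Aᴴ := by
  have := h.mul_mul_conjTranspose_same A
  rwa [Matrix.mul_sub, Matrix.sub_mul] at this

lemma conj_nonneg {X : Matrix a a ℂ} (h : 0 ≤ X) (A : Matrix b a ℂ) :
    0 ≤ A * X * Aᴴ := (h.posSemidef.mul_mul_conjTranspose_same A).nonneg

lemma _root_.Matrix.PosDef.conj_isUnit {X : Matrix a a ℂ} (h : X.PosDef) {A : Matrix a a ℂ}
    (hA : IsUnit A) : (A * X * Aᴴ).PosDef :=
  (IsUnit.posDef_star_right_conjugate_iff hA).2 h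

lemma _root_.Matrix.PosDef.of_le {X Y : Matrix a a ℂ} (hX : X.PosDef) (h : X ≤ Y) : Y.PosDef :=
  (hX.isStrictlyPositive.of_le h).posDef

/-! ### Functional calculus in an eigenbasis -/

lemma conj_diagonal_pow {U : Matrix a a ℂ} (hU : Uᴴ * U = 1) (hU' : U * Uᴴ = 1) (D : Matrix a a ℂ)
    (n : ℕ) : (U * D * Uᴴ) ^ n = U * D ^ n * Uᴴ := by
  induction n with
  | zero => simp [hU']
  | succ n ih =>
    rw [pow_succ, ih, pow_succ]
    calc U * D ^ n * Uᴴ * (U * D * Uᴴ) = U * D ^ n * (Uᴴ * U) * D * Uᴴ := by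
          simp only [mul_assoc]
      _ = _ := by rw [hU]; simp only [mul_assoc, one_mul]

/-- On a finite set f agrees with a Lagrange interpolation polynomial, and for polynomials the
formula is algebra. -/
lemma cfc_conj_diagonal {U : Matrix a a ℂ} (hU : Uᴴ * U = 1) (d : a → ℝ) (f : ℝ → ℝ) :
    cfc f (U * diagonal (fun i => (d i : ℂ)) * Uᴴ) = U * diagonal (fun i => (f (d i) : ℂ)) * Uᴴ := by
  have hU' : U * Uᴴ = 1 := mul_eq_one_comm.1 hU
  set A := U * diagonal (fun i => (d i : ℂ)) * Uᴴ with hA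
  have hAs : IsSelfAdjoint A := by
    rw [IsSelfAdjoint, star_eq_conjTranspose, hA, conjTranspose_mul, conjTranspose_mul,
      diagonal_conjTranspose, conjTranspose_conjTranspose, ← mul_assoc]
    congr 3
    ext i
    simp
  -- Interpolating on both sets avoids having to know that the spectrum consists of the `d i`.
  let s : Finset ℝ := A.finite_real_spectrum.toFinset ∪ Finset.univ.image d
  let p : Polynomial ℝ := Lagrange.interpolate s id f
  have hp : ∀ x ∈ s, p.eval x = f x := fun x hx =>
    Lagrange.eval_interpolate_at_node (v := id) f (Set.injOn_id _) hx
  have h1 : cfc f A = cfc (fun x => p.eval x) A :=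
    cfc_congr fun x hx => (hp x (by simp [s, hx])).symm
  have h2 : ∀ q : Polynomial ℝ, Polynomial.aeval A q =
      U * diagonal (fun i => ((q.eval (d i) : ℝ) : ℂ)) * Uᴴ := by
    intro q
    induction q using Polynomial.induction_on' with
    | add p q hp hq =>
      rw [map_add, hp, hq, ← add_mul, ← mul_add, diagonal_add]
      simp
    | monomial n r =>
      rw [Polynomial.aeval_monomial, hA, conj_diagonal_pow hU hU', diagonal_pow,
        ← Algebra.smul_def, ← smul_mul_assoc, ← mul_smul_comm]
      congr 2
      ext i j
      simp [diagonal_apply]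
  rw [h1, cfc_polynomial p A hAs, h2]
  congr 3
  ext i
  rw [hp _ (by simp [s])]

lemma _root_.Matrix.IsHermitian.exists_diagonalization {A : Matrix a a ℂ} (hA : A.IsHermitian) :
    ∃ (U : Matrix a a ℂ) (d : a → ℝ), Uᴴ * U = 1 ∧ U * Uᴴ = 1 ∧
      A = U * diagonal (fun i => (d i : ℂ)) * Uᴴ := by
  refine ⟨hA.eigenvectorUnitary, hA.eigenvalues, ?_, ?_, ?_⟩
  · exact Unitary.coe_star_mul_self hA.eigenvectorUnitary
  · exact Unitary.coe_mul_star_self hA.eigenvectorUnitary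
  · conv_lhs => rw [hA.spectral_theorem]
    simp [Unitary.conjStarAlgAut_apply, star_eq_conjTranspose, Function.comp_def]

lemma conj_diagonal_nonneg_iff {U : Matrix a a ℂ} (hU : Uᴴ * U = 1) (d : a → ℝ) :
    0 ≤ U * diagonal (fun i => (d i : ℂ)) * Uᴴ ↔ ∀ i, 0 ≤ d i := by
  have hU' : U * Uᴴ = 1 := mul_eq_one_comm.1 hU
  have hUu : IsUnit U := IsUnit.of_mul_eq_one _ hU'
  rw [nonneg_iff_posSemidef, ← star_eq_conjTranspose, IsUnit.posSemidef_star_right_conjugate_iff hUu,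
    posSemidef_diagonal_iff]
  simp

lemma conj_diagonal_posDef_iff {U : Matrix a a ℂ} (hU : Uᴴ * U = 1) (d : a → ℝ) :
    (U * diagonal (fun i => (d i : ℂ)) * Uᴴ).PosDef ↔ ∀ i, 0 < d i := by
  have hU' : U * Uᴴ = 1 := mul_eq_one_comm.1 hU
  have hUu : IsUnit U := IsUnit.of_mul_eq_one _ hU'
  rw [← star_eq_conjTranspose, IsUnit.posDef_star_right_conjugate_iff hUu,
    posDef_diagonal_iff]
  simp

/-- Otherwise the indicator function of `d i` would vanish on the spectrum, while its value at the
operator has diagonal entry 1 in the eigenbasis. -/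
lemma mem_spectrum_conj_diagonal {U : Matrix a a ℂ} (hU : Uᴴ * U = 1) (d : a → ℝ) (i : a) :
    d i ∈ spectrum ℝ (U * diagonal (fun i => (d i : ℂ)) * Uᴴ) := by
  set A := U * diagonal (fun i => (d i : ℂ)) * Uᴴ with hA
  by_contra hi
  have hU' : U * Uᴴ = 1 := mul_eq_one_comm.1 hU
  have h1 : cfc (fun x => if x = d i then (1 : ℝ) else 0) A = 0 := by
    rw [cfc_congr (g := fun _ => 0) fun x hx => ?_]
    · exact cfc_zero ..
    · simp only [ite_eq_right_iff, one_ne_zero, imp_false]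
      rintro rfl
      exact hi hx
  rw [hA, cfc_conj_diagonal hU] at h1
  have h2 := congr((Uᴴ * $h1 * U) i i)
  simp only [← mul_assoc, hU, one_mul, mul_zero, zero_mul] at h2
  rw [mul_assoc, hU, mul_one] at h2
  simp at h2

lemma cfc_isHermitian (f : ℝ → ℝ) (A : Matrix a a ℂ) : (cfc f A).IsHermitian :=
  cfc_predicate f A

lemma cfc_mul_cfc (f g : ℝ → ℝ) (A : Matrix a a ℂ) :
    cfc f A * cfc g A = cfc (fun x => f x * g x) A :=
  (cfc_mul f g A (A.finite_real_spectrum.continuousOn f) (A.finite_real_spectrum.continuousOn g)).symm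

lemma cfc_add_cfc (f g : ℝ → ℝ) (A : Matrix a a ℂ) :
    cfc f A + cfc g A = cfc (fun x => f x + g x) A :=
  (cfc_add A f g (A.finite_real_spectrum.continuousOn f)
    (A.finite_real_spectrum.continuousOn g)).symm

lemma cfc_cfc (f g : ℝ → ℝ) {A : Matrix a a ℂ} (hA : A.IsHermitian) :
    cfc f (cfc g A) = cfc (fun x => f (g x)) A :=
  (cfc_comp' f g A ((A.finite_real_spectrum.image g).continuousOn f)
    (A.finite_real_spectrum.continuousOn g) hA).symm

/-! ### Product operators -/

lemma tensorProd_mul (X Y : Fin n → Matrix a a ℂ) :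
    tensorProd X * tensorProd Y = tensorProd fun m => X m * Y m := by
  ext k l
  simp only [tensorProd, mul_apply, of_apply, ← Finset.prod_mul_distrib]
  rw [Finset.prod_univ_sum, Fintype.piFinset_univ]

lemma tensorProd_conjTranspose (X : Fin n → Matrix a a ℂ) :
    (tensorProd X)ᴴ = tensorProd fun m => (X m)ᴴ := by
  ext k l
  simp [tensorProd, conjTranspose_apply]

lemma trace_tensorProd (X : Fin n → Matrix a a ℂ) :
    (tensorProd X).trace = ∏ m, (X m).trace := by
  simp only [tensorProd, trace, diag_apply, of_apply]
  rw [Finset.prod_univ_sum, Fintype.piFinset_univ]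

lemma tensorProd_diagonal (d : Fin n → a → ℂ) :
    tensorProd (fun m => diagonal (d m)) = diagonal fun k => ∏ m, d m (k m) := by
  ext k l
  simp only [tensorProd, of_apply, diagonal_apply]
  split_ifs with h
  · subst h; simp
  · obtain ⟨m, hm⟩ := Function.ne_iff.1 h
    exact Finset.prod_eq_zero (Finset.mem_univ m) (by simp [hm])

lemma tensorProd_one : tensorProd (fun _ : Fin n => (1 : Matrix a a ℂ)) = 1 := by
  have := tensorProd_diagonal (n := n) (fun _ => (1 : a → ℂ))
  simpa using this

/-- The `n`-fold power `X ⊗ ⋯ ⊗ X`. -/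
noncomputable def tpow (n : ℕ) (X : Matrix a a ℂ) : Matrix (Fin n → a) (Fin n → a) ℂ :=
  tensorProd fun _ => X

lemma tpow_mul (X Y : Matrix a a ℂ) : tpow n (X * Y) = tpow n X * tpow n Y :=
  (tensorProd_mul _ _).symm

lemma tpow_conjTranspose (X : Matrix a a ℂ) : tpow n Xᴴ = (tpow n X)ᴴ :=
  (tensorProd_conjTranspose _).symm

lemma tpow_one : tpow n (1 : Matrix a a ℂ) = 1 := tensorProd_one

lemma trace_tpow (X : Matrix a a ℂ) : (tpow n X).trace = X.trace ^ n := by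
  simp [tpow, trace_tensorProd]

lemma tpow_conj_diagonal (U : Matrix a a ℂ) (d : a → ℝ) :
    tpow n (U * diagonal (fun i => (d i : ℂ)) * Uᴴ) =
      tpow n U * diagonal (fun k => ((∏ m, d (k m) : ℝ) : ℂ)) * (tpow n U)ᴴ := by
  rw [tpow_mul, tpow_mul, tpow_conjTranspose]
  congr 2
  simp [tpow, tensorProd_diagonal]

lemma tpow_unitary {U : Matrix a a ℂ} (hU : Uᴴ * U = 1) : (tpow n U)ᴴ * tpow n U = 1 := by
  rw [← tpow_conjTranspose, ← tpow_mul, hU, tpow_one]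

lemma tpow_isUnit {U : Matrix a a ℂ} (hU : IsUnit U) : IsUnit (tpow n U) := by
  obtain ⟨V, hV⟩ := isUnit_iff_exists_inv.1 hU
  exact IsUnit.of_mul_eq_one (tpow n V) (by rw [← tpow_mul, hV, tpow_one])

lemma tpow_nonneg {X : Matrix a a ℂ} (hX : 0 ≤ X) : 0 ≤ tpow n X := by
  obtain ⟨B, rfl⟩ := CStarAlgebra.nonneg_iff_eq_star_mul_self.mp hX
  rw [star_eq_conjTranspose, tpow_mul, tpow_conjTranspose]
  exact (posSemidef_conjTranspose_mul_self _).nonneg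

lemma tpow_posDef {X : Matrix a a ℂ} (hX : X.PosDef) : (tpow n X).PosDef :=
  ((tpow_nonneg hX.posSemidef.nonneg).posSemidef.posDef_iff_isUnit).2 (tpow_isUnit hX.isUnit)

lemma tpow_isDensity {X : Matrix a a ℂ} (hX : IsDensity X) : IsDensity (tpow n X) :=
  ⟨(tpow_nonneg hX.1.nonneg).posSemidef, by rw [trace_tpow, hX.2, one_pow]⟩

lemma matrix_eq_sum_smul_single (X : Matrix a a ℂ) :
    X = ∑ i, ∑ j, X i j • Matrix.single i j (1 : ℂ) := by
  conv_lhs => rw [matrix_eq_sum_single X]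
  simp [Matrix.smul_single]

lemma tensorPower_tensorProd (N : Matrix a a ℂ →ₗ[ℂ] Matrix b b ℂ)
    (X : Fin n → Matrix a a ℂ) :
    tensorPower n N (tensorProd X) = tensorProd fun m => N (X m) := by
  have hN (m : Fin n) (p q : b) :
      N (X m) p q = ∑ i, ∑ j, X m i j * N (Matrix.single i j 1) p q := by
    conv_lhs => rw [matrix_eq_sum_smul_single (X m)]
    simp only [map_sum, map_smul, Matrix.sum_apply, Matrix.smul_apply, smul_eq_mul]
  ext p q
  simp only [tensorPower, LinearMap.coe_mk, AddHom.coe_mk, Matrix.sum_apply, Matrix.smul_apply,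
    smul_eq_mul, tensorProd, of_apply, hN, ← Finset.prod_mul_distrib]
  rw [Finset.prod_univ_sum, Fintype.piFinset_univ]
  refine Finset.sum_congr rfl fun k _ => ?_
  rw [Finset.prod_univ_sum, Fintype.piFinset_univ]

lemma tensorPower_tpow (N : Matrix a a ℂ →ₗ[ℂ] Matrix b b ℂ) (X : Matrix a a ℂ) :
    tensorPower n N (tpow n X) = tpow n (N X) :=
  tensorPower_tensorProd N _

lemma tensorPower_single (N : Matrix a a ℂ →ₗ[ℂ] Matrix b b ℂ) (k l : Fin n → a) :
    tensorPower n N (Matrix.single k l 1) = tensorProd fun m => N (Matrix.single (k m) (l m) 1) := by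
  have : Matrix.single k l (1 : ℂ) = tensorProd fun m => Matrix.single (k m) (l m) (1 : ℂ) := by
    ext p q
    simp only [tensorProd, of_apply, Matrix.single_apply]
    rw [Finset.prod_ite_zero]
    simp only [Finset.mem_univ, true_implies, Finset.prod_const_one]
    congr 1
    simp only [funext_iff, forall_and]
  rw [this, tensorPower_tensorProd]

/-! ### Logarithm of a product operator -/

/-- Linearity of expectation under a product weight: in each summand the other factors have total
mass one. -/
lemma sum_prod_mul_sum {r g : a → ℝ} (hr : ∑ i, r i = 1) (n : ℕ) :
    ∑ k : Fin n → a, (∏ m, r (k m)) * ∑ m, g (k m) = n * ∑ i, r i * g i := by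
  have h1 (j : Fin n) : ∑ k : Fin n → a, (∏ m, r (k m)) * g (k j) = ∑ i, r i * g i := by
    have h2 : ∀ k : Fin n → a, (∏ m, r (k m)) * g (k j) =
        ∏ m, r (k m) * (if m = j then g (k m) else 1) := by
      intro k
      rw [Finset.prod_mul_distrib]
      simp
    simp only [h2]
    have h3 := Finset.prod_univ_sum (fun _ : Fin n => (Finset.univ : Finset a))
      (fun m i => r i * (if m = j then g i else 1))
    rw [Fintype.piFinset_univ] at h3
    rw [← h3, Finset.prod_eq_single j]
    · simp
    · intro m _ hm
      simp [hm, hr]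
    · simp
  simp only [Finset.mul_sum]
  rw [Finset.sum_comm]
  simp [h1, Finset.mul_sum]

lemma retr_mul_conj_diagonal (U R : Matrix a a ℂ) (d : a → ℝ) :
    retr (R * (U * diagonal (fun i => (d i : ℂ)) * Uᴴ)) = ∑ i, ((Uᴴ * R * U) i i).re * d i := by
  rw [← mul_assoc, ← mul_assoc, retr_mul_comm, ← mul_assoc, ← mul_assoc, retr_apply, trace]
  simp [mul_diagonal]

/-- Additivity of the logarithm on product eigenvalues. Since `Real.log 0 = 0`, additivity fails for
tuples containing a zero eigenvalue; `h` gives these tuples weight zero. -/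
lemma retr_tpow_mul_log_conj_diagonal {U : Matrix a a ℂ} (hU : Uᴴ * U = 1) (d : a → ℝ)
    {R : Matrix a a ℂ} (hR : R.IsHermitian) (hRt : R.trace = 1)
    (h : ∀ i, d i = 0 → (Uᴴ * R * U) i i = 0) :
    retr (tpow n R * opLog (tpow n (U * diagonal (fun i => (d i : ℂ)) * Uᴴ))) =
      n * retr (R * opLog (U * diagonal (fun i => (d i : ℂ)) * Uᴴ)) := by
  have hU' : U * Uᴴ = 1 := mul_eq_one_comm.1 hU
  rw [opLog, opLog, tpow_conj_diagonal, cfc_conj_diagonal hU, cfc_conj_diagonal (tpow_unitary hU),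
    retr_mul_conj_diagonal, retr_mul_conj_diagonal]
  have him : ∀ i, ((((Uᴴ * R * U) i i).re : ℝ) : ℂ) = (Uᴴ * R * U) i i := by
    intro i
    have hh : (Uᴴ * R * U).IsHermitian := by
      rw [IsHermitian, conjTranspose_mul, conjTranspose_mul, conjTranspose_conjTranspose, hR.eq,
        mul_assoc]
    exact Complex.conj_eq_iff_re.1 (hh.apply i i)
  have hsum : ∑ i, ((Uᴴ * R * U) i i).re = 1 := by
    have h1 : (Uᴴ * R * U).trace = 1 := by rw [trace_mul_comm, ← mul_assoc, hU', one_mul, hRt]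
    have h2 := congr(Complex.re $h1)
    simpa [trace] using h2
  rw [← sum_prod_mul_sum hsum]
  refine Finset.sum_congr rfl fun k _ => ?_
  have h3 : ((tpow n U)ᴴ * tpow n R * tpow n U) k k = ∏ m, (Uᴴ * R * U) (k m) (k m) := by
    rw [← tpow_conjTranspose, ← tpow_mul, ← tpow_mul]
    rfl
  have h4 : (((tpow n U)ᴴ * tpow n R * tpow n U) k k).re = ∏ m, ((Uᴴ * R * U) (k m) (k m)).re := by
    rw [h3, ← Complex.ofReal_re (∏ m, _), Complex.ofReal_prod]
    simp only [him]
  rw [h4]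
  by_cases h0 : ∃ m, d (k m) = 0
  · obtain ⟨m, hm⟩ := h0
    rw [Finset.prod_eq_zero (Finset.mem_univ m) (by rw [h _ hm]; rfl)]
    simp
  · push Not at h0
    rw [Real.log_prod fun m _ => h0 m]

lemma retr_tpow_mul_log_tpow {X R : Matrix a a ℂ} (hX : X.PosDef) (hR : R.IsHermitian)
    (hRt : R.trace = 1) :
    retr (tpow n R * opLog (tpow n X)) = n * retr (R * opLog X) := by
  obtain ⟨U, d, hU, -, rfl⟩ := hX.1.exists_diagonalization
  have hd := (conj_diagonal_posDef_iff hU d).1 hX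
  exact retr_tpow_mul_log_conj_diagonal hU d hR hRt fun i hi => absurd hi (hd i).ne'

lemma retr_tpow_mul_log_tpow_self {R : Matrix a a ℂ} (hR : R.IsHermitian) (hRt : R.trace = 1) :
    retr (tpow n R * opLog (tpow n R)) = n * retr (R * opLog R) := by
  obtain ⟨U, d, hU, hU', h⟩ := hR.exists_diagonalization
  have := retr_tpow_mul_log_conj_diagonal (n := n) hU d hR hRt fun i hi => ?_
  · rwa [← h] at this
  · have h1 : Uᴴ * R * U = diagonal (fun i => (d i : ℂ)) := by
      rw [h, ← mul_assoc, ← mul_assoc, hU, one_mul, mul_assoc, hU, mul_one]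
    rw [h1]
    simp [hi]

/-! ### The Hilbert–Schmidt adjoint -/

lemma trace_conjTranspose_mul_hsAdjoint (N : Matrix a a ℂ →ₗ[ℂ] Matrix b b ℂ)
    (X : Matrix a a ℂ) (Y : Matrix b b ℂ) :
    (Xᴴ * hsAdjoint N Y).trace = ((N X)ᴴ * Y).trace := by
  conv_rhs => rw [matrix_eq_sum_smul_single X]
  simp only [map_sum, map_smul, conjTranspose_sum, conjTranspose_smul, Finset.sum_mul,
    Matrix.trace_sum, smul_mul_assoc, trace_smul]
  simp only [trace, diag_apply, mul_apply, conjTranspose_apply, hsAdjoint, LinearMap.coe_mk,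
    AddHom.coe_mk, of_apply, smul_eq_mul]
  rw [Finset.sum_comm]

lemma IsPositiveMap.map_nonneg {N : Matrix a a ℂ →ₗ[ℂ] Matrix b b ℂ} (hN : IsPositiveMap N)
    {X : Matrix a a ℂ} (hX : 0 ≤ X) : 0 ≤ N X := (hN X hX.posSemidef).nonneg

lemma IsPositiveMap.mono {N : Matrix a a ℂ →ₗ[ℂ] Matrix b b ℂ} (hN : IsPositiveMap N)
    {X Y : Matrix a a ℂ} (h : X ≤ Y) : N X ≤ N Y := by
  have := hN.map_nonneg (sub_nonneg.2 h)
  rwa [map_sub, sub_nonneg] at this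

lemma retr_mul_hsAdjoint {N : Matrix a a ℂ →ₗ[ℂ] Matrix b b ℂ} (hN : IsPositiveMap N)
    {X : Matrix a a ℂ} (hX : 0 ≤ X) (Y : Matrix b b ℂ) :
    retr (X * hsAdjoint N Y) = retr (N X * Y) := by
  have := trace_conjTranspose_mul_hsAdjoint N X Y
  rw [hX.posSemidef.1.eq, (hN X hX.posSemidef).1.eq] at this
  rw [retr_apply, this, retr_apply]

lemma nonneg_of_trace_mul_nonneg {X : Matrix a a ℂ}
    (h : ∀ v : a → ℂ, 0 ≤ (vecMulVec v (star v) * X).trace) : 0 ≤ X := by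
  rw [nonneg_iff_posSemidef]
  have h1 : ∀ v : a → ℂ, 0 ≤ star v ⬝ᵥ (X *ᵥ v) := by
    intro v
    have := h v
    rwa [vecMulVec_mul, trace_vecMulVec, dotProduct_comm, ← dotProduct_mulVec] at this
  rw [← Matrix.isPositive_toEuclideanLin_iff, LinearMap.isPositive_iff_complex]
  intro v
  have h2 := h1 v.ofLp
  have h3 : inner ℂ (X.toEuclideanLin v) v = star (star v.ofLp ⬝ᵥ (X *ᵥ v.ofLp)) := by
    rw [← star_dotProduct]
    simp [EuclideanSpace.inner_eq_star_dotProduct, dotProduct_comm]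
  rw [h3]
  rw [Complex.le_def] at h2
  have h4 : (star v.ofLp ⬝ᵥ (X *ᵥ v.ofLp)).im = 0 := h2.2.symm
  refine ⟨Complex.ext ?_ ?_, ?_⟩
  · simp
  · simp [h4]
  · simpa using h2.1

/-- The positive cone is self-dual for the trace pairing, so testing against rank-one operators
suffices. -/
lemma hsAdjoint_isPositiveMap {N : Matrix a a ℂ →ₗ[ℂ] Matrix b b ℂ} (hN : IsPositiveMap N) :
    IsPositiveMap (hsAdjoint N) := by
  intro Y hY
  refine (nonneg_of_trace_mul_nonneg fun v => ?_).posSemidef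
  have hv := posSemidef_vecMulVec_self_star v
  have := trace_conjTranspose_mul_hsAdjoint N (vecMulVec v (star v)) Y
  rw [hv.1.eq, (hN _ hv).1.eq] at this
  rw [this]
  obtain ⟨B, hB⟩ := CStarAlgebra.nonneg_iff_eq_star_mul_self.mp hY.nonneg
  rw [hB, ← mul_assoc, trace_mul_comm, ← mul_assoc]
  exact ((hN _ hv).mul_mul_conjTranspose_same B).trace_nonneg

lemma hsAdjoint_one {N : Matrix a a ℂ →ₗ[ℂ] Matrix b b ℂ} (hN : IsTracePreserving N) :
    hsAdjoint N 1 = 1 := by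
  ext i j
  simp only [hsAdjoint, LinearMap.coe_mk, AddHom.coe_mk, of_apply, mul_one, trace_conjTranspose]
  rw [hN]
  by_cases h : i = j
  · subst h; simp
  · simp [h]

lemma hsAdjoint_tensorPower_tensorProd (N : Matrix a a ℂ →ₗ[ℂ] Matrix b b ℂ)
    (Y : Fin n → Matrix b b ℂ) :
    hsAdjoint (tensorPower n N) (tensorProd Y) = tensorProd fun m => hsAdjoint N (Y m) := by
  ext k l
  simp only [hsAdjoint, LinearMap.coe_mk, AddHom.coe_mk, of_apply, tensorPower_single,
    tensorProd_conjTranspose, tensorProd_mul, trace_tensorProd]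
  rfl

lemma hsAdjoint_tensorPower_tpow (N : Matrix a a ℂ →ₗ[ℂ] Matrix b b ℂ) (Y : Matrix b b ℂ) :
    hsAdjoint (tensorPower n N) (tpow n Y) = tpow n (hsAdjoint N Y) :=
  hsAdjoint_tensorPower_tensorProd N _

lemma hsAdjoint_tensorPower_one {N : Matrix a a ℂ →ₗ[ℂ] Matrix b b ℂ} (hN : IsTracePreserving N) :
    hsAdjoint (tensorPower n N) 1 = 1 := by
  rw [← tpow_one, hsAdjoint_tensorPower_tpow, hsAdjoint_one hN, tpow_one]

/-- The case of one tensor factor, with constant tuples identifying `b` with `Fin 1 → b`. -/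
lemma IsTensorStablePositive.isPositiveMap {N : Matrix a a ℂ →ₗ[ℂ] Matrix b b ℂ}
    (hN : IsTensorStablePositive N) : IsPositiveMap N := by
  intro X hX
  have h := hN 1 (tpow 1 X) (tpow_nonneg hX.nonneg).posSemidef
  rw [tensorPower_tpow] at h
  have h1 := h.submatrix (fun i : b => fun _ : Fin 1 => i)
  convert h1
  ext i j
  simp [tpow, tensorProd]

/-! ### Klein's inequality -/

/-- Gibbs' inequality for an unnormalised `z`, from log t ≤ t − 1 at t = z/(pS) with S the total
mass of `z`. -/
lemma sum_mul_log_sub_log_le {ι : Type*} [Fintype ι] {p z : ι → ℝ} (hp : ∀ i, 0 ≤ p i)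
    (hp1 : ∑ i, p i = 1) (hz : ∀ i, 0 ≤ z i) (hpz : ∀ i, 0 < p i → 0 < z i) :
    ∑ i, p i * (Real.log (z i) - Real.log (p i)) ≤ Real.log (∑ i, z i) := by
  set S := ∑ i, z i with hS
  have hSpos : 0 < S := by
    obtain ⟨i, -, hi⟩ : ∃ i ∈ Finset.univ, 0 < p i :=
      Finset.exists_lt_of_sum_lt (by simp [hp1])
    exact Finset.sum_pos' (fun i _ => hz i) ⟨i, Finset.mem_univ i, hpz i hi⟩
  have h (i : ι) : p i * (Real.log (z i) - Real.log (p i)) ≤ p i * Real.log S + (z i / S - p i) := by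
    rcases (hp i).eq_or_lt with h0 | h0
    · rw [← h0]
      have := div_nonneg (hz i) hSpos.le
      simpa using this
    · have hzi := hpz i h0
      have h1 := Real.log_le_sub_one_of_pos (x := z i / (p i * S)) (by positivity)
      rw [Real.log_div hzi.ne' (by positivity), Real.log_mul h0.ne' hSpos.ne'] at h1
      have h2 := mul_le_mul_of_nonneg_left h1 h0.le
      have h3 : p i * (z i / (p i * S) - 1) = z i / S - p i := by field_simp
      nlinarith
  calc _ ≤ ∑ i, (p i * Real.log S + (z i / S - p i)) := Finset.sum_le_sum fun i _ => h i
    _ = Real.log S := by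
      rw [Finset.sum_add_distrib, Finset.sum_sub_distrib, ← Finset.sum_mul, ← Finset.sum_div, hp1,
        ← hS, div_self hSpos.ne']
      ring

/-- The tangent of log at `t`, applied to the spectrum. With `t` a diagonal entry of `Z` it yields
Jensen's inequality for that entry. -/
lemma opLog_le_affine {Z : Matrix a a ℂ} (hZ : Z.PosDef) {t : ℝ} (ht : 0 < t) :
    opLog Z ≤ (Real.log t - 1) • (1 : Matrix a a ℂ) + t⁻¹ • Z := by
  obtain ⟨U, d, hU, hU', rfl⟩ := hZ.1.exists_diagonalization
  have hd := (conj_diagonal_posDef_iff hU d).1 hZ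
  rw [opLog, cfc_conj_diagonal hU, ← sub_nonneg]
  have h1 : (Real.log t - 1) • (1 : Matrix a a ℂ) = U * diagonal (fun _ =>
      ((Real.log t - 1 : ℝ) : ℂ)) * Uᴴ := by
    have h0 : diagonal (fun _ : a => ((Real.log t - 1 : ℝ) : ℂ)) =
      (Real.log t - 1) • (1 : Matrix a a ℂ) := by
      ext i j
      simp [diagonal_apply, one_apply]
    rw [h0, mul_smul_comm, smul_mul_assoc, mul_one, hU']
  have h2 : t⁻¹ • (U * diagonal (fun i => (d i : ℂ)) * Uᴴ) =
      U * diagonal (fun i => ((t⁻¹ * d i : ℝ) : ℂ)) * Uᴴ := by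
    rw [← smul_mul_assoc, ← mul_smul_comm]
    congr 2
    ext i j
    simp [diagonal_apply]
  rw [h1, h2, ← add_mul, ← mul_add, ← sub_mul, ← mul_sub, diagonal_add, diagonal_sub]
  simp only [← Complex.ofReal_add, ← Complex.ofReal_sub]
  rw [conj_diagonal_nonneg_iff hU]
  intro i
  have := Real.log_le_sub_one_of_pos (x := d i / t) (div_pos (hd i) ht)
  rw [Real.log_div (hd i).ne' ht.ne'] at this
  rw [sub_nonneg, inv_mul_eq_div]
  linarith

lemma diag_re_nonneg {X : Matrix a a ℂ} (hX : 0 ≤ X) (i : a) : 0 ≤ (X i i).re :=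
  (Complex.le_def.1 (hX.posSemidef.diag_nonneg (i := i))).1

lemma density_retr {ω : Matrix a a ℂ} (hω : IsDensity ω) : retr ω = 1 := by
  rw [retr_apply, hω.2]; rfl

/-- Klein's inequality. -/
lemma retr_mul_log_sub_log_le {ω Z : Matrix a a ℂ} (hω : IsDensity ω) (hZ : Z.PosDef) :
    retr (ω * (opLog Z - opLog ω)) ≤ Real.log (retr Z) := by
  obtain ⟨U, p, hU, hU', rfl⟩ := hω.1.1.exists_diagonalization
  have hp := (conj_diagonal_nonneg_iff hU p).1 hω.1.nonneg
  have hp1 : ∑ i, p i = 1 := by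
    have := retr_mul_conj_diagonal U 1 p
    rw [one_mul, mul_one, hU, density_retr hω] at this
    simpa using this.symm
  set z : a → ℝ := fun i => ((Uᴴ * Z * U) i i).re with hz
  have hUu : IsUnit Uᴴ := IsUnit.of_mul_eq_one U hU
  have hZ' : (Uᴴ * Z * U).PosDef := by simpa using hZ.conj_isUnit hUu
  have hzpos : ∀ i, 0 < z i := fun i => (Complex.lt_def.1 (hZ'.diag_pos (i := i))).1
  have hzsum : ∑ i, z i = retr Z := by
    have := retr_mul_conj_diagonal U Z (fun _ => 1)
    simpa [hU', hz] using this.symm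
  -- Peierls' argument: taking the tangent at `z i` itself makes the affine bound equal to log(z i)
  -- on the i-th diagonal entry. The claim is thereby reduced to the classical inequality for p and
  -- z.
  have hlog (i : a) : ((Uᴴ * opLog Z * U) i i).re ≤ Real.log (z i) := by
    have h1 := conj_mono (opLog_le_affine hZ (hzpos i)) Uᴴ
    have h2 := diag_re_nonneg (sub_nonneg.2 h1) i
    rw [conjTranspose_conjTranspose, mul_add, add_mul, mul_smul_comm, mul_smul_comm, smul_mul_assoc,
      smul_mul_assoc, mul_one, hU] at h2
    simp only [Matrix.sub_apply, Matrix.add_apply, Matrix.smul_apply, one_apply_eq, Complex.sub_re, Complex.add_re,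
      Complex.real_smul, Complex.re_ofReal_mul, Complex.one_re] at h2
    have h3 : (z i)⁻¹ * ((Uᴴ * Z * U) i i).re = 1 := inv_mul_cancel₀ (hzpos i).ne'
    linarith
  rw [mul_sub, map_sub, retr_mul_comm, retr_mul_conj_diagonal,
    retr_mul_comm (U * _ * _) (opLog (U * _ * _)), retr_mul_conj_diagonal]
  have h4 : ∀ i, ((Uᴴ * opLog (U * diagonal (fun i => (p i : ℂ)) * Uᴴ) * U) i i).re =
      Real.log (p i) := by
    intro i
    rw [opLog, cfc_conj_diagonal hU, ← mul_assoc, ← mul_assoc, hU, one_mul, mul_assoc, hU, mul_one]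
    simp
  simp only [h4]
  rw [← Finset.sum_sub_distrib, ← hzsum]
  refine le_trans (Finset.sum_le_sum fun i _ => ?_)
    (sum_mul_log_sub_log_le hp hp1 (fun i => (hzpos i).le) fun i _ => hzpos i)
  have := mul_le_mul_of_nonneg_left (hlog i) (hp i)
  linarith

/-! ### Commuting operators -/

lemma opSqrt_mul_self {X : Matrix a a ℂ} (hX : 0 ≤ X) : opSqrt X * opSqrt X = X := by
  rw [opSqrt, cfc_mul_cfc]
  conv_rhs => rw [← cfc_id ℝ X hX.posSemidef.1]
  refine cfc_congr fun x hx => ?_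
  exact Real.mul_self_sqrt (spectrum_nonneg_of_nonneg hX hx)

lemma commute_cfc {X Y : Matrix a a ℂ} (h : Commute X Y) (f : ℝ → ℝ) :
    Commute X (cfc f Y) :=
  ((h.symm.cfc_real f) : Commute (cfc f Y) X).symm

/-- By commutation XY = √Y X √Y. -/
lemma posDef_mul_of_commute {X Y : Matrix a a ℂ} (hX : X.PosDef) (hY : Y.PosDef)
    (h : Commute X Y) : (X * Y).PosDef := by
  have hs := opSqrt_mul_self hY.posSemidef.nonneg
  have hc : Commute X (opSqrt Y) := commute_cfc h _
  have hu : IsUnit (opSqrt Y) := by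
    have := hY.isUnit
    rw [← hs] at this
    exact isUnit_of_mul_isUnit_left this
  have := hX.conj_isUnit hu
  rw [show (opSqrt Y)ᴴ = opSqrt Y from cfc_isHermitian Real.sqrt Y, ← hc.eq, mul_assoc, hs] at this
  exact this

lemma opLog_mul_of_commute {X Y : Matrix a a ℂ} (hX : X.PosDef) (hY : Y.PosDef)
    (h : Commute X Y) : opLog (X * Y) = opLog X + opLog Y := by
  have h1 : Commute (opLog X) (opLog Y) :=
    (commute_cfc (commute_cfc h _).symm _).symm
  have h2 : NormedSpace.exp (opLog X + opLog Y) = X * Y := by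
    rw [Matrix.exp_add_of_commute _ _ h1]
    exact congrArg₂ _ (CFC.exp_log X hX.isStrictlyPositive) (CFC.exp_log Y hY.isStrictlyPositive)
  rw [← h2]
  exact CFC.log_exp _ ((cfc_isHermitian _ X).add (cfc_isHermitian _ Y))

/-! ### Averaging over rotations -/

noncomputable instance instFintypeSpectrum (A : Matrix a a ℂ) : Fintype (spectrum ℝ A) :=
  Fintype.ofFinite _

lemma rotation_conj_diagonal {U : Matrix a a ℂ} (hU : Uᴴ * U = 1) (d : a → ℝ)
    (θ : spectrum ℝ (U * diagonal (fun i => (d i : ℂ)) * Uᴴ) → ℝ) :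
    rotation (U * diagonal (fun i => (d i : ℂ)) * Uᴴ) θ =
      U * diagonal (fun i =>
        Complex.exp (Complex.I * (θ ⟨d i, mem_spectrum_conj_diagonal hU d i⟩ : ℂ))) * Uᴴ := by
  rw [rotation, finsum_eq_sum_of_fintype]
  simp only [eigenProj]
  have h (k : ℝ) : cfc (fun y : ℝ => if y = k then (1 : ℝ) else 0)
      (U * diagonal (fun i => (d i : ℂ)) * Uᴴ) =
      U * diagonal (fun i => (((if d i = k then 1 else 0 : ℝ)) : ℂ)) * Uᴴ :=
    cfc_conj_diagonal hU d _
  have h' (c : ℂ) (D : Matrix a a ℂ) : c • (U * D * Uᴴ) = U * (c • D) * Uᴴ := by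
    rw [mul_smul_comm, smul_mul_assoc]
  simp only [h, h']
  rw [← Finset.sum_mul, ← Finset.mul_sum]
  congr 2
  ext i j
  by_cases hij : i = j
  · subst hij
    rw [Matrix.sum_apply, Finset.sum_eq_single ⟨d i, mem_spectrum_conj_diagonal hU d i⟩]
    · simp
    · intro k _ hk
      have : d i ≠ k := fun h => hk (Subtype.ext h.symm)
      simp [this]
    · simp
  · simp [Matrix.sum_apply, hij]

lemma rotation_unitary {Y : Matrix a a ℂ} (hY : Y.IsHermitian) (θ : spectrum ℝ Y → ℝ) :
    (rotation Y θ)ᴴ * rotation Y θ = 1 := by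
  obtain ⟨U, d, hU, hU', rfl⟩ := hY.exists_diagonalization
  rw [rotation_conj_diagonal hU, conjTranspose_mul, conjTranspose_mul, conjTranspose_conjTranspose,
    diagonal_conjTranspose]
  set D := diagonal fun i =>
        Complex.exp (Complex.I * (θ ⟨d i, mem_spectrum_conj_diagonal hU d i⟩ : ℂ))
  calc _ = U * (diagonal (star fun i => Complex.exp (Complex.I *
          (θ ⟨d i, mem_spectrum_conj_diagonal hU d i⟩ : ℂ))) * (Uᴴ * U) * D) * Uᴴ := by
        simp only [mul_assoc]
    _ = 1 := by
      rw [hU, mul_one, diagonal_mul_diagonal]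
      have : (fun i => (star fun i => Complex.exp (Complex.I *
          (θ ⟨d i, mem_spectrum_conj_diagonal hU d i⟩ : ℂ))) i * Complex.exp (Complex.I *
          (θ ⟨d i, mem_spectrum_conj_diagonal hU d i⟩ : ℂ))) = fun _ => 1 := by
        ext i
        simp [← Complex.exp_conj, ← Complex.exp_add]
      rw [this, diagonal_one, mul_one, hU']

lemma rotation_commute_cfc {Y : Matrix a a ℂ} (θ : spectrum ℝ Y → ℝ)
    (f : ℝ → ℝ) : Commute (rotation Y θ) (cfc f Y) := by
  rw [rotation, finsum_eq_sum_of_fintype]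
  refine Finset.sum_induction _ (fun A => Commute A (cfc f Y)) (fun _ _ => Commute.add_left)
    (Commute.zero_left _) fun k _ => Commute.smul_left ?_ _
  exact cfc_commute_cfc _ _ _

lemma rotation_zero {Y : Matrix a a ℂ} (hY : Y.IsHermitian) :
    rotation Y (fun _ => 0) = 1 := by
  obtain ⟨U, d, hU, hU', rfl⟩ := hY.exists_diagonalization
  rw [rotation_conj_diagonal hU]
  simp [hU']

/-- Angles which are multiples of `2π / (n + 1)`. -/
noncomputable def phase {S : Type*} {n : ℕ} (j : S → Fin (n + 1)) : S → ℝ :=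
  fun k => 2 * Real.pi * ((j k : ℕ) : ℝ) / (n + 1)

lemma phase_mem {S : Type*} (j : S → Fin (n + 1)) (k : S) :
    phase j k ∈ Set.Icc 0 (2 * Real.pi) := by
  have h : ((j k : ℕ) : ℝ) ≤ n + 1 := by exact_mod_cast (j k).2.le
  constructor
  · unfold phase; positivity
  · rw [phase, div_le_iff₀ (by positivity)]
    exact mul_le_mul_of_nonneg_left h Real.two_pi_pos.le

/-- The sum of the conjugates of `X` by the `n`-fold powers of the rotations of `Y` with angles in
`{2πj / (n + 1)}`; up to a factor it is a pinching. -/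
noncomputable def twirl (Y : Matrix a a ℂ) (X : Matrix (Fin n → a) (Fin n → a) ℂ) :
    Matrix (Fin n → a) (Fin n → a) ℂ :=
  ∑ j : spectrum ℝ Y → Fin (n + 1),
    tpow n (rotation Y (phase j)) * X * (tpow n (rotation Y (phase j)))ᴴ

/-- The term with all angles zero is X and the others are nonnegative; this plays the role of the
pinching inequality. -/
lemma le_twirl {Y : Matrix a a ℂ} (hY : Y.IsHermitian) {X : Matrix (Fin n → a) (Fin n → a) ℂ}
    (hX : 0 ≤ X) : X ≤ twirl Y X := by
  have h := Finset.single_le_sum (s := Finset.univ)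
    (f := fun j : spectrum ℝ Y → Fin (n + 1) =>
      tpow n (rotation Y (phase j)) * X * (tpow n (rotation Y (phase j)))ᴴ)
    (fun j _ => conj_nonneg hX _) (Finset.mem_univ (fun _ => 0))
  have h0 : rotation Y (phase (n := n) fun _ => 0) = 1 := by
    rw [← rotation_zero hY]
    congr 1
    ext k
    simp [phase]
  simp only [h0, tpow_one, one_mul, conjTranspose_one, mul_one] at h
  exact h

/-- Rotations of Y commute with functions of Y, so by cyclicity all terms of the twirl have the same
trace; the factor counts them. -/
lemma retr_twirl_mul {Y : Matrix a a ℂ} (hY : Y.IsHermitian) (f : ℝ → ℝ)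
    (X : Matrix (Fin n → a) (Fin n → a) ℂ) :
    retr (twirl Y X * tpow n (cfc f Y)) =
      ((n : ℝ) + 1) ^ Fintype.card (spectrum ℝ Y) * retr (X * tpow n (cfc f Y)) := by
  rw [twirl, Finset.sum_mul, map_sum]
  have h (j : spectrum ℝ Y → Fin (n + 1)) :
      retr (tpow n (rotation Y (phase j)) * X * (tpow n (rotation Y (phase j)))ᴴ *
        tpow n (cfc f Y)) = retr (X * tpow n (cfc f Y)) := by
    set W := rotation Y (phase j)
    have hc : cfc f Y * W = W * cfc f Y := (rotation_commute_cfc (phase j) f).eq.symm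
    have hW : Wᴴ * W = 1 := rotation_unitary hY _
    rw [mul_assoc, mul_assoc, retr_mul_comm, mul_assoc, mul_assoc, ← tpow_conjTranspose, ← tpow_mul,
      ← tpow_mul, hc, ← mul_assoc, hW, one_mul]
  simp [h]

/-! ### Types of index tuples, and commutation of the twirl -/

lemma prod_eq_prod_pow_card {S M : Type*} [Fintype S] [DecidableEq S] [CommMonoid M]
    (c : Fin n → S) (g : S → M) :
    ∏ m, g (c m) = ∏ s, g s ^ (Finset.univ.filter fun m => c m = s).card := by
  rw [← Finset.prod_fiberwise' Finset.univ c g]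
  simp

lemma sum_pow_eq_zero {w : ℂ} (hw : w ^ (n + 1) = 1) (h : w ≠ 1) :
    ∑ t : Fin (n + 1), w ^ (t : ℕ) = 0 := by
  rw [Fin.sum_univ_eq_sum_range (fun t => w ^ t), geom_sum_eq h, hw, sub_self, zero_div]

/-- The kernel of the average over rotations vanishes unless the two index tuples have the same
type. -/
lemma card_eq_of_sum_ne_zero {S : Type*} [Fintype S] [DecidableEq S] (c c' : Fin n → S)
    (h : ∑ j : S → Fin (n + 1), (∏ m, Complex.exp (Complex.I * (phase j (c m) : ℂ))) *
      ∏ m, star (Complex.exp (Complex.I * (phase j (c' m) : ℂ))) ≠ 0) (s : S) :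
    (Finset.univ.filter fun m => c m = s).card = (Finset.univ.filter fun m => c' m = s).card := by
  set z : ℂ := Complex.exp (2 * Real.pi * Complex.I / ((n + 1 : ℕ) : ℂ)) with hz
  have hprim : IsPrimitiveRoot z (n + 1) := Complex.isPrimitiveRoot_exp _ (Nat.succ_ne_zero n)
  have hz1 : z * star z = 1 := by
    rw [hz]
    rw [← starRingEnd_apply, ← Complex.exp_conj, ← Complex.exp_add]
    simp [neg_div, map_ofNat]
  have hexp (j : S → Fin (n + 1)) (s : S) :
      Complex.exp (Complex.I * (phase j s : ℂ)) = z ^ (j s : ℕ) := by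
    rw [hz, ← Complex.exp_nat_mul]
    congr 1
    simp [phase]
    ring
  set N := fun s => (Finset.univ.filter fun m => c m = s).card with hN
  set N' := fun s => (Finset.univ.filter fun m => c' m = s).card with hN'
  have hterm (j : S → Fin (n + 1)) : (∏ m, Complex.exp (Complex.I * (phase j (c m) : ℂ))) *
      ∏ m, star (Complex.exp (Complex.I * (phase j (c' m) : ℂ))) =
      ∏ s, (z ^ N s * star z ^ N' s) ^ (j s : ℕ) := by
    simp only [hexp, star_pow]
    rw [prod_eq_prod_pow_card c (fun s => z ^ (j s : ℕ)),
      prod_eq_prod_pow_card c' (fun s => star z ^ (j s : ℕ)), ← Finset.prod_mul_distrib]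
    refine Finset.prod_congr rfl fun s _ => ?_
    rw [mul_pow, ← pow_mul, ← pow_mul, ← pow_mul, ← pow_mul, mul_comm (j s : ℕ),
      mul_comm (j s : ℕ)]
  simp only [hterm] at h
  have h2 := Finset.prod_univ_sum (fun _ : S => (Finset.univ : Finset (Fin (n + 1))))
      (fun s t => (z ^ N s * star z ^ N' s) ^ (t : ℕ))
  rw [Fintype.piFinset_univ] at h2
  rw [← h2, Finset.prod_ne_zero_iff] at h
  have h3 := h s (Finset.mem_univ s)
  -- This number is an (n+1)-th root of unity; unless it is 1, its geometric sum vanishes.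
  have hw1 : z ^ N s * star z ^ N' s = 1 := by
    by_contra hne
    refine h3 (sum_pow_eq_zero ?_ hne)
    have hz' : star z ^ (n + 1) = 1 := by rw [← star_pow, hprim.pow_eq_one, star_one]
    rw [mul_pow, ← pow_mul, ← pow_mul, mul_comm (N s), mul_comm (N' s), pow_mul, pow_mul,
      hprim.pow_eq_one, hz', one_pow, one_pow, one_mul]
  have h4 : z ^ N s = z ^ N' s := by
    calc z ^ N s = z ^ N s * (z * star z) ^ N' s := by rw [hz1, one_pow, mul_one]
      _ = (z ^ N s * star z ^ N' s) * z ^ N' s := by rw [mul_pow]; ring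
      _ = _ := by rw [hw1, one_mul]
  -- Multiplicities are at most n, so n + 1 equally spaced angles distinguish them.
  have hcard (c : Fin n → S) : (Finset.univ.filter fun m => c m = s).card < n + 1 :=
    Nat.lt_succ_of_le ((Finset.card_le_univ _).trans (by simp))
  exact hprim.pow_inj (hcard c) (hcard c') h4

/-- In the product eigenbasis the twirl keeps only entries between tuples in which each eigenvalue
of Y occurs equally often. The eigenvalue of the power of f(Y) depends only on these multiplicities.
-/
lemma twirl_commute {Y : Matrix a a ℂ} (hY : Y.IsHermitian) (f : ℝ → ℝ)
    (X : Matrix (Fin n → a) (Fin n → a) ℂ) : Commute (twirl Y X) (tpow n (cfc f Y)) := by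
  classical
  obtain ⟨U, d, hU, hU', rfl⟩ := hY.exists_diagonalization
  set S := spectrum ℝ (U * diagonal (fun i => (d i : ℂ)) * Uᴴ)
  set e : a → S := fun i => ⟨d i, mem_spectrum_conj_diagonal hU d i⟩ with he
  set V := tpow n U with hV
  have hVV : Vᴴ * V = 1 := tpow_unitary hU
  have hVV' : V * Vᴴ = 1 := mul_eq_one_comm.1 hVV
  set D : (S → Fin (n + 1)) → Matrix (Fin n → a) (Fin n → a) ℂ := fun j =>
    diagonal fun k => ∏ m, Complex.exp (Complex.I * (phase j (e (k m)) : ℂ)) with hD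
  have hrot (j : S → Fin (n + 1)) :
      tpow n (rotation (U * diagonal (fun i => (d i : ℂ)) * Uᴴ) (phase j)) = V * D j * Vᴴ := by
    rw [rotation_conj_diagonal hU, tpow_mul, tpow_mul, tpow_conjTranspose]
    congr 2
    simp [tpow, tensorProd_diagonal, hD, he]
  set M := ∑ j, D j * (Vᴴ * X * V) * (D j)ᴴ with hM
  have htw : twirl (U * diagonal (fun i => (d i : ℂ)) * Uᴴ) X = V * M * Vᴴ := by
    rw [twirl, hM, Finset.mul_sum, Finset.sum_mul]
    refine Finset.sum_congr rfl fun j _ => ?_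
    rw [hrot]
    simp only [conjTranspose_mul, conjTranspose_conjTranspose, mul_assoc]
  set F := diagonal (fun k : Fin n → a => ((∏ m, f (d (k m)) : ℝ) : ℂ)) with hF
  have hcfc : tpow n (cfc f (U * diagonal (fun i => (d i : ℂ)) * Uᴴ)) = V * F * Vᴴ := by
    rw [cfc_conj_diagonal hU, tpow_conj_diagonal]
  have hMF : M * F = F * M := by
    ext k l
    rw [hF, mul_diagonal, diagonal_mul]
    have hMkl : M k l = (∑ j : S → Fin (n + 1),
        (∏ m, Complex.exp (Complex.I * (phase j (e (k m)) : ℂ))) *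
          ∏ m, star (Complex.exp (Complex.I * (phase j (e (l m)) : ℂ)))) * (Vᴴ * X * V) k l := by
      rw [hM, Matrix.sum_apply, Finset.sum_mul]
      refine Finset.sum_congr rfl fun j _ => ?_
      rw [hD, diagonal_conjTranspose, mul_diagonal, diagonal_mul]
      simp only [Pi.star_apply, star_prod]
      ring
    rw [hMkl]
    by_cases h0 : ∑ j : S → Fin (n + 1),
        (∏ m, Complex.exp (Complex.I * (phase j (e (k m)) : ℂ))) *
          ∏ m, star (Complex.exp (Complex.I * (phase j (e (l m)) : ℂ))) = 0
    · rw [h0]; ring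
    · have hc := card_eq_of_sum_ne_zero (fun m => e (k m)) (fun m => e (l m)) h0
      have h1 : ∏ m, f (d (k m)) = ∏ m, f (d (l m)) := by
        have h2 := prod_eq_prod_pow_card (fun m => e (k m)) (fun s => f s)
        have h3 := prod_eq_prod_pow_card (fun m => e (l m)) (fun s => f s)
        simp only [hc, ← h3] at h2
        exact h2
      rw [h1]; ring
  rw [htw, hcfc, Commute, SemiconjBy]
  calc V * M * Vᴴ * (V * F * Vᴴ) = V * M * (Vᴴ * V) * F * Vᴴ := by simp only [mul_assoc]
    _ = V * (M * F) * Vᴴ := by rw [hVV]; simp only [mul_assoc, one_mul]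
    _ = V * F * (Vᴴ * V) * M * Vᴴ := by rw [hMF, hVV]; simp only [mul_assoc, one_mul]
    _ = _ := by simp only [mul_assoc]

/-! ### The Golden–Thompson inequality -/

/-- A polynomial factor is lost on taking n-th roots: a ratio x/y > 1 would grow exponentially. -/
lemma le_of_forall_pow_le {x y : ℝ} (hy : 0 < y) (D : ℕ)
    (h : ∀ n : ℕ, x ^ n ≤ ((n : ℝ) + 1) ^ D * y ^ n) : x ≤ y := by
  by_contra! hxy
  set r := x / y with hr
  have hr1 : 1 < r := (one_lt_div hy).2 hxy
  have hr0 : 0 < r := one_pos.trans hr1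
  -- Dividing by the (n+1)-th power gives k^D / r^k with k = n + 1, which tends to 0, at the cost of
  -- the constant `r⁻¹` on the left.
  have h1 : ∀ n : ℕ, r⁻¹ ≤ (((n + 1 : ℕ) : ℝ)) ^ D / r ^ (n + 1) := by
    intro n
    rw [le_div_iff₀ (by positivity), pow_succ', ← mul_assoc, inv_mul_cancel₀ hr0.ne', one_mul, hr,
      div_pow, div_le_iff₀ (by positivity)]
    exact_mod_cast h n
  have h2 := (tendsto_pow_const_div_const_pow_of_one_lt D hr1).comp (Filter.tendsto_add_atTop_nat 1)
  have h3 := ge_of_tendsto' h2 h1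
  exact absurd h3 (not_le.2 (inv_pos.2 hr0))

lemma retr_tpow_mul_tpow {X Y : Matrix a a ℂ} (hX : X.IsHermitian) (hY : Y.IsHermitian) :
    retr (tpow n X * tpow n Y) = retr (X * Y) ^ n := by
  rw [← tpow_mul, retr_apply, trace_tpow, trace_mul_eq_retr hX hY, ← Complex.ofReal_pow, Complex.ofReal_re]

/-- The Golden–Thompson inequality, in variational form. -/
lemma retr_mul_log_add_log_sub_log_le {ω X Y : Matrix a a ℂ} (hω : IsDensity ω) (hX : X.PosDef)
    (hY : Y.PosDef) :
    retr (ω * (opLog X + opLog Y - opLog ω)) ≤ Real.log (retr (X * Y)) := by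
  have hω0 : ω ≠ 0 := by
    rintro rfl
    simpa using hω.2
  have hne : Nonempty a := by
    by_contra h
    rw [not_nonempty_iff] at h
    exact hω0 (Subsingleton.elim _ _)
  have hX0 : X ≠ 0 := by
    rintro rfl
    obtain ⟨i⟩ := hne
    simpa using hX.diag_pos (i := i)
  have hpos : 0 < retr (X * Y) := retr_mul_pos hX.posSemidef.nonneg hX0 hY
  rw [Real.le_log_iff_exp_le hpos]
  -- The left side is additive under tensor powers. After twirling X^{⊗n} with respect to Y the two
  -- factors commute, their logarithms add and Klein's inequality applies; the twirl costs only a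
  -- polynomial factor.
  refine le_of_forall_pow_le hpos (Fintype.card (spectrum ℝ Y)) fun n => ?_
  set x := retr (ω * (opLog X + opLog Y - opLog ω)) with hx
  have hid : cfc (fun x : ℝ => x) Y = Y := cfc_id ℝ Y hY.1
  have htX := tpow_posDef (n := n) hX
  have htY := tpow_posDef (n := n) hY
  have hle := le_twirl (n := n) hY.1 htX.posSemidef.nonneg
  have htw : (twirl Y (tpow n X)).PosDef := htX.of_le hle
  have hcomm : Commute (twirl Y (tpow n X)) (tpow n Y) := by
    have := twirl_commute (n := n) hY.1 (fun x => x) (tpow n X)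
    rwa [hid] at this
  have h1 : n * x = retr (tpow n ω * (opLog (tpow n X) + opLog (tpow n Y) - opLog (tpow n ω))) := by
    simp only [hx, mul_sub, mul_add, map_sub, map_add]
    rw [
      retr_tpow_mul_log_tpow hX hω.1.1 hω.2, retr_tpow_mul_log_tpow hY hω.1.1 hω.2,
      retr_tpow_mul_log_tpow_self hω.1.1 hω.2]
  have h2 : opLog (tpow n X) ≤ opLog (twirl Y (tpow n X)) :=
    CFC.log_le_log hle htX.isStrictlyPositive
  have h3 : n * x ≤ Real.log (((n : ℝ) + 1) ^ Fintype.card (spectrum ℝ Y) *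
      retr (X * Y) ^ n) := by
    rw [h1, ← retr_tpow_mul_tpow hX.1 hY.1]
    have h4 := retr_twirl_mul (n := n) hY.1 (fun x => x) (tpow n X)
    rw [hid] at h4
    rw [← h4]
    refine le_trans ?_ (retr_mul_log_sub_log_le (tpow_isDensity hω)
      (posDef_mul_of_commute htw htY hcomm))
    rw [opLog_mul_of_commute htw htY hcomm]
    exact retr_mul_le_mul_left (tpow_nonneg hω.1.nonneg) (by gcongr)
  rw [← Real.exp_nat_mul]
  exact (Real.le_log_iff_exp_le (by positivity)).1 h3

/-! ### Operator Jensen inequality for positive unital maps -/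

lemma smul_one_eq_conj_diagonal {U : Matrix a a ℂ} (hU : Uᴴ * U = 1) (c : ℝ) :
    c • (1 : Matrix a a ℂ) = U * diagonal (fun _ => (c : ℂ)) * Uᴴ := by
  have h0 : diagonal (fun _ : a => (c : ℂ)) = c • (1 : Matrix a a ℂ) := by
    ext i j
    simp [diagonal_apply, one_apply]
  rw [h0, mul_smul_comm, smul_mul_assoc, mul_one, mul_eq_one_comm.1 hU]

lemma _root_.Matrix.PosDef.exists_smul_one_le {Y : Matrix a a ℂ} (hY : Y.PosDef) :
    ∃ c : ℝ, 0 < c ∧ c • (1 : Matrix a a ℂ) ≤ Y := by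
  obtain ⟨U, d, hU, hU', rfl⟩ := hY.1.exists_diagonalization
  have hd := (conj_diagonal_posDef_iff hU d).1 hY
  obtain ⟨c, hc, hcd⟩ : ∃ c : ℝ, 0 < c ∧ ∀ i, c ≤ d i := by
    rcases isEmpty_or_nonempty a with h | h
    · exact ⟨1, one_pos, fun i => (h.false i).elim⟩
    · obtain ⟨i, hi⟩ := Finite.exists_min d
      exact ⟨d i, hd i, hi⟩
  refine ⟨c, hc, ?_⟩
  rw [smul_one_eq_conj_diagonal hU, ← sub_nonneg, ← sub_mul, ← mul_sub, diagonal_sub]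
  simp only [← Complex.ofReal_sub]
  rw [conj_diagonal_nonneg_iff hU]
  exact fun i => sub_nonneg.2 (hcd i)

lemma _root_.Matrix.IsHermitian.exists_le_smul_one {Y : Matrix a a ℂ} (hY : Y.IsHermitian) :
    ∃ c : ℝ, 0 < c ∧ Y ≤ c • (1 : Matrix a a ℂ) := by
  obtain ⟨U, d, hU, hU', rfl⟩ := hY.exists_diagonalization
  obtain ⟨c, hc, hcd⟩ : ∃ c : ℝ, 0 < c ∧ ∀ i, d i ≤ c :=
    ⟨1 + ∑ i, |d i|, by positivity, fun i => by
      have := Finset.single_le_sum (f := fun i => |d i|) (fun i _ => abs_nonneg _)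
        (Finset.mem_univ i)
      have h2 := le_abs_self (d i)
      linarith⟩
  refine ⟨c, hc, ?_⟩
  rw [smul_one_eq_conj_diagonal hU, ← sub_nonneg, ← sub_mul, ← mul_sub, diagonal_sub]
  simp only [← Complex.ofReal_sub]
  rw [conj_diagonal_nonneg_iff hU]
  exact fun i => sub_nonneg.2 (hcd i)

lemma posDef_smul_one {c : ℝ} (hc : 0 < c) : (c • (1 : Matrix a a ℂ)).PosDef :=
  PosDef.one.smul hc

lemma map_real_smul (L : Matrix b b ℂ →ₗ[ℂ] Matrix a a ℂ) (c : ℝ) (X : Matrix b b ℂ) :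
    L (c • X) = c • L X := by
  rw [← Complex.coe_smul, map_smul, Complex.coe_smul]

lemma IsPositiveMap.map_posDef {L : Matrix b b ℂ →ₗ[ℂ] Matrix a a ℂ} (hL : IsPositiveMap L)
    (h1 : L 1 = 1) {Y : Matrix b b ℂ} (hY : Y.PosDef) : (L Y).PosDef := by
  obtain ⟨c, hc, h⟩ := hY.exists_smul_one_le
  have h2 := hL.mono h
  rw [map_real_smul, h1] at h2
  exact (posDef_smul_one hc).of_le h2

/-- Kadison's inequality. -/
lemma IsPositiveMap.map_mul_map_le {L : Matrix b b ℂ →ₗ[ℂ] Matrix a a ℂ} (hL : IsPositiveMap L)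
    (h1 : L 1 = 1) {S : Matrix b b ℂ} (hS : S.IsHermitian) : L S * L S ≤ L (S * S) := by
  obtain ⟨U, s, hU, hU', rfl⟩ := hS.exists_diagonalization
  set E : b → Matrix a a ℂ := fun i => L (U * Matrix.single i i 1 * Uᴴ) with hE
  have hdiag (d : b → ℝ) : L (U * diagonal (fun i => (d i : ℂ)) * Uᴴ) = ∑ i, d i • E i := by
    have h2 : diagonal (fun i => (d i : ℂ)) = ∑ i, (d i : ℂ) • Matrix.single i i (1 : ℂ) := by
      rw [← sum_single_eq_diagonal]
      simp [Matrix.smul_single]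
    rw [h2, Finset.mul_sum, Finset.sum_mul, map_sum]
    refine Finset.sum_congr rfl fun i _ => ?_
    rw [mul_smul_comm, smul_mul_assoc, map_smul, Complex.coe_smul]
  have hEnn (i : b) : 0 ≤ E i := by
    refine hL.map_nonneg (conj_nonneg ?_ U)
    rw [← diagonal_single]
    refine (PosSemidef.diagonal fun j => ?_).nonneg
    by_cases h : i = j
    · subst h; simp
    · simp [h]
  have hE1 : ∑ i, E i = 1 := by
    have := hdiag fun _ => 1
    simp only [Complex.ofReal_one, diagonal_one, mul_one, hU', h1, one_smul] at this
    exact this.symm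
  have hsq : U * diagonal (fun i => (s i : ℂ)) * Uᴴ * (U * diagonal (fun i => (s i : ℂ)) * Uᴴ) =
      U * diagonal (fun i => ((s i * s i : ℝ) : ℂ)) * Uᴴ := by
    calc _ = U * (diagonal (fun i => (s i : ℂ)) * (Uᴴ * U) * diagonal (fun i => (s i : ℂ))) * Uᴴ := by
          simp only [mul_assoc]
      _ = _ := by
        rw [hU, mul_one, diagonal_mul_diagonal]
        simp
  rw [hsq, hdiag, hdiag]
  set m := ∑ i, s i • E i with hm
  have hmH : mᴴ = m := by
    rw [hm, conjTranspose_sum]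
    refine Finset.sum_congr rfl fun i _ => ?_
    rw [conjTranspose_smul, (hEnn i).posSemidef.1.eq, star_trivial]
  -- The images `E i` of the spectral projectors form a resolution of the identity; nonnegativity of
  -- the operator variance about the mean m is the inequality.
  have hsum : 0 ≤ ∑ i, (s i • (1 : Matrix a a ℂ) - m) * E i * (s i • (1 : Matrix a a ℂ) - m)ᴴ :=
    Finset.sum_nonneg fun i _ => conj_nonneg (hEnn i) _
  have hexp : ∑ i, (s i • (1 : Matrix a a ℂ) - m) * E i * (s i • (1 : Matrix a a ℂ) - m)ᴴ =
      ∑ i, (s i * s i) • E i - m * m := by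
    have h3 (i : b) : (s i • (1 : Matrix a a ℂ) - m) * E i * (s i • (1 : Matrix a a ℂ) - m)ᴴ =
        (s i * s i) • E i - (s i • E i) * m - m * (s i • E i) + m * E i * m := by
      rw [conjTranspose_sub, hmH, conjTranspose_smul, conjTranspose_one, star_trivial]
      simp only [sub_mul, mul_sub, smul_mul_assoc, mul_smul_comm, one_mul, mul_one, smul_sub, smul_smul]
      abel
    simp only [h3, Finset.sum_add_distrib, Finset.sum_sub_distrib, ← Finset.sum_mul,
      ← Finset.mul_sum, hE1, ← hm]
    rw [mul_one]
    abel
  rw [hexp] at hsum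
  exact sub_nonneg.1 hsum

/-! ### From square roots to the logarithm under positive unital maps -/

lemma opSqrt_nonneg (X : Matrix a a ℂ) : 0 ≤ opSqrt X := cfc_nonneg fun x _ => Real.sqrt_nonneg x

lemma opSqrt_isHermitian (X : Matrix a a ℂ) : (opSqrt X).IsHermitian := cfc_isHermitian _ _

lemma opSqrt_eq_sqrt {X : Matrix a a ℂ} (hX : 0 ≤ X) : opSqrt X = CFC.sqrt X :=
  (CFC.sqrt_unique (opSqrt_mul_self hX) (opSqrt_nonneg X)).symm

lemma opSqrt_mono {X Y : Matrix a a ℂ} (hX : 0 ≤ X) (h : X ≤ Y) : opSqrt X ≤ opSqrt Y := by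
  rw [opSqrt_eq_sqrt hX, opSqrt_eq_sqrt (hX.trans h)]
  exact CFC.sqrt_le_sqrt X Y h

lemma opSqrt_mul_self_eq {X : Matrix a a ℂ} (hX : 0 ≤ X) : opSqrt (X * X) = X := by
  have h : 0 ≤ X * X := by
    have := (posSemidef_conjTranspose_mul_self X).nonneg
    rwa [hX.posSemidef.1.eq] at this
  rw [opSqrt_eq_sqrt h, CFC.sqrt_unique rfl hX]

/-- Kadison's inequality for √Y, followed by operator monotonicity of the square root. -/
lemma IsPositiveMap.map_opSqrt_le {L : Matrix b b ℂ →ₗ[ℂ] Matrix a a ℂ} (hL : IsPositiveMap L)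
    (h1 : L 1 = 1) {Y : Matrix b b ℂ} (hY : 0 ≤ Y) : L (opSqrt Y) ≤ opSqrt (L Y) := by
  have h2 := hL.map_mul_map_le h1 (opSqrt_isHermitian Y)
  rw [opSqrt_mul_self hY] at h2
  have h3 : 0 ≤ L (opSqrt Y) := hL.map_nonneg (opSqrt_nonneg Y)
  have h4 : 0 ≤ L (opSqrt Y) * L (opSqrt Y) := by
    have := (posSemidef_conjTranspose_mul_self (L (opSqrt Y))).nonneg
    rwa [h3.posSemidef.1.eq] at this
  rw [← opSqrt_mul_self_eq h3]
  exact opSqrt_mono h4 h2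

lemma iterate_opSqrt_nonneg {Y : Matrix b b ℂ} (hY : 0 ≤ Y) (k : ℕ) : 0 ≤ opSqrt^[k] Y := by
  cases k with
  | zero => exact hY
  | succ k =>
    rw [Function.iterate_succ_apply']
    exact opSqrt_nonneg _

lemma IsPositiveMap.map_iterate_opSqrt_le {L : Matrix b b ℂ →ₗ[ℂ] Matrix a a ℂ}
    (hL : IsPositiveMap L) (h1 : L 1 = 1) {Y : Matrix b b ℂ} (hY : 0 ≤ Y) (k : ℕ) :
    L (opSqrt^[k] Y) ≤ opSqrt^[k] (L Y) := by
  induction k with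
  | zero => rfl
  | succ k ih =>
    rw [Function.iterate_succ_apply', Function.iterate_succ_apply']
    exact (hL.map_opSqrt_le h1 (iterate_opSqrt_nonneg hY k)).trans
      (opSqrt_mono (hL.map_nonneg (iterate_opSqrt_nonneg hY k)) ih)

lemma iterate_opSqrt_eq_cfc {Y : Matrix b b ℂ} (hY : 0 ≤ Y) (k : ℕ) :
    opSqrt^[k] Y = cfc (fun x : ℝ => x ^ ((1 / 2 : ℝ) ^ k)) Y := by
  induction k with
  | zero =>
    simp only [Function.iterate_zero, id, pow_zero, Real.rpow_one]
    exact (cfc_id' ℝ Y hY.posSemidef.1).symm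
  | succ k ih =>
    rw [Function.iterate_succ_apply', ih, opSqrt, cfc_cfc _ _ hY.posSemidef.1]
    refine cfc_congr fun x hx => ?_
    have hx0 : 0 ≤ x := spectrum_nonneg_of_nonneg hY hx
    rw [Real.sqrt_eq_rpow, ← Real.rpow_mul hx0, pow_succ]

-- The logarithm is the limit of (Y^h − 1)/h; the exponents h = 2^{-k} are those reachable by
-- iterated square roots, for which Jensen's inequality is available.
open Filter Topology in
lemma tendsto_iterate_opSqrt {Y : Matrix b b ℂ} (hY : Y.PosDef) :
    Tendsto (fun k : ℕ => ((1 / 2 : ℝ) ^ k)⁻¹ • (opSqrt^[k] Y - 1)) atTop (𝓝 (opLog Y)) := by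
  have h1 := CFC.tendsto_cfc_rpow_sub_one_log hY.isStrictlyPositive
  have h2 : Tendsto (fun k : ℕ => (1 / 2 : ℝ) ^ k) atTop (𝓝[>] 0) :=
    tendsto_nhdsWithin_iff.2 ⟨tendsto_pow_atTop_nhds_zero_of_lt_one (by norm_num) (by norm_num),
      Eventually.of_forall fun k => by simp⟩
  refine (h1.comp h2).congr fun k => ?_
  rw [iterate_opSqrt_eq_cfc hY.posSemidef.nonneg]
  simp only [Function.comp]
  rw [cfc_const_mul _ _ _ (Y.finite_real_spectrum.continuousOn _),
    cfc_sub _ _ _ (Y.finite_real_spectrum.continuousOn _)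
      (Y.finite_real_spectrum.continuousOn _)]
  congr 2
  exact cfc_const_one ℝ Y hY.1

/-- Operator Jensen inequality for the logarithm and a positive unital map. -/
lemma IsPositiveMap.map_opLog_le {L : Matrix b b ℂ →ₗ[ℂ] Matrix a a ℂ} (hL : IsPositiveMap L)
    (h1 : L 1 = 1) {Y : Matrix b b ℂ} (hY : Y.PosDef) : L (opLog Y) ≤ opLog (L Y) := by
  have hc : Continuous L := (L.restrictScalars ℝ).continuous_of_finiteDimensional
  refine le_of_tendsto_of_tendsto' ((hc.tendsto _).comp (tendsto_iterate_opSqrt hY))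
    (tendsto_iterate_opSqrt (hL.map_posDef h1 hY)) fun k => ?_
  simp only [Function.comp]
  rw [map_real_smul, map_sub, h1]
  have := hL.map_iterate_opSqrt_le h1 hY.posSemidef.nonneg k
  gcongr

/-! ### The trace inequality for rotated Petz maps -/

/-- The map `X ↦ U s L(q V X Vᴴ q) s Uᴴ`. -/
noncomputable def petzMap (L : Matrix b b ℂ →ₗ[ℂ] Matrix a a ℂ) (s U : Matrix a a ℂ)
    (q V : Matrix b b ℂ) : Matrix b b ℂ →ₗ[ℂ] Matrix a a ℂ :=
  conjMap U ∘ₗ sandwich s ∘ₗ L ∘ₗ sandwich q ∘ₗ conjMap V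

lemma petzMap_apply (L : Matrix b b ℂ →ₗ[ℂ] Matrix a a ℂ) (s U : Matrix a a ℂ)
    (q V X : Matrix b b ℂ) :
    petzMap L s U q V X = U * (s * L (q * (V * X * Vᴴ) * q) * s) * Uᴴ := rfl

/-- Inverse rotations realised with angles that stay in [0, 2π]. -/
lemma rotation_two_pi_sub {Y : Matrix a a ℂ} (hY : Y.IsHermitian) (θ : spectrum ℝ Y → ℝ) :
    rotation Y (fun k => 2 * Real.pi - θ k) = (rotation Y θ)ᴴ := by
  obtain ⟨U, d, hU, hU', rfl⟩ := hY.exists_diagonalization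
  rw [rotation_conj_diagonal hU, rotation_conj_diagonal hU, conjTranspose_mul, conjTranspose_mul,
    conjTranspose_conjTranspose, diagonal_conjTranspose, mul_assoc]
  congr 3
  ext i
  rw [Pi.star_apply, ← starRingEnd_apply, ← Complex.exp_conj]
  simp only [map_mul, Complex.conj_I, Complex.conj_ofReal, Complex.ofReal_sub, Complex.ofReal_mul,
    Complex.ofReal_ofNat, mul_sub, Complex.exp_sub]
  rw [show Complex.I * (2 * Real.pi) = 2 * Real.pi * Complex.I by ring, Complex.exp_two_pi_mul_I,
    neg_mul, Complex.exp_neg, one_div]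

lemma isDensity_map {N : Matrix a a ℂ →ₗ[ℂ] Matrix b b ℂ} (hTP : IsTracePreserving N)
    (hN : IsPositiveMap N) {ρ : Matrix a a ℂ} (hρ : IsDensity ρ) : IsDensity (N ρ) :=
  ⟨hN ρ hρ.1, by rw [hTP, hρ.2]⟩

/-- Each pair of terms of the two twirls is a trace of n-fold powers, hence an n-th power. Cyclicity
moves the rotation of σ from H to the recovered operator, as its adjoint; hence the angles 2π −
`phase j k`. -/
lemma sum_retr_pow {N : Matrix a a ℂ →ₗ[ℂ] Matrix b b ℂ} (hN : IsPositiveMap N)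
    {σ : Matrix a a ℂ} {τ : Matrix b b ℂ} (hσ : σ.IsHermitian)
    {s : Matrix a a ℂ} {q : Matrix b b ℂ} (hs : s.IsHermitian) (hq : q.IsHermitian)
    {H : Matrix a a ℂ} (hH : H.PosDef) {η : Matrix b b ℂ} (hη : η.PosDef) :
    retr (tpow n s * twirl σ (tpow n H) * tpow n s *
      hsAdjoint (tensorPower n N) (tpow n q * twirl τ (tpow n η) * tpow n q)) =
    ∑ j : spectrum ℝ σ → Fin (n + 1), ∑ l : spectrum ℝ τ → Fin (n + 1),
      retr (H * petzMap (hsAdjoint N) s (rotation σ fun k => 2 * Real.pi - phase j k) q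
        (rotation τ (phase l)) η) ^ n := by
  have h1 : tpow n s * twirl σ (tpow n H) * tpow n s = ∑ j : spectrum ℝ σ → Fin (n + 1),
      tpow n (s * (rotation σ (phase j) * H * (rotation σ (phase j))ᴴ) * s) := by
    rw [twirl, Finset.mul_sum, Finset.sum_mul]
    simp only [tpow_mul, tpow_conjTranspose]
  have h2 : tpow n q * twirl τ (tpow n η) * tpow n q = ∑ l : spectrum ℝ τ → Fin (n + 1),
      tpow n (q * (rotation τ (phase l) * η * (rotation τ (phase l))ᴴ) * q) := by
    rw [twirl, Finset.mul_sum, Finset.sum_mul]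
    simp only [tpow_mul, tpow_conjTranspose]
  have hpos (l : spectrum ℝ τ → Fin (n + 1)) :
      (q * (rotation τ (phase l) * η * (rotation τ (phase l))ᴴ) * q).PosSemidef := by
    have := (hη.posSemidef.mul_mul_conjTranspose_same (rotation τ (phase l))
      ).mul_mul_conjTranspose_same q
    rwa [hq.eq] at this
  have hpos' (j : spectrum ℝ σ → Fin (n + 1)) :
      (s * (rotation σ (phase j) * H * (rotation σ (phase j))ᴴ) * s).PosSemidef := by
    have := (hH.posSemidef.mul_mul_conjTranspose_same (rotation σ (phase j))
      ).mul_mul_conjTranspose_same s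
    rwa [hs.eq] at this
  rw [h1, h2, map_sum, Finset.sum_mul_sum, map_sum]
  refine Finset.sum_congr rfl fun j _ => ?_
  rw [map_sum]
  refine Finset.sum_congr rfl fun l _ => ?_
  rw [hsAdjoint_tensorPower_tpow, retr_tpow_mul_tpow (hpos' j).1
    (hsAdjoint_isPositiveMap hN _ (hpos l)).1, petzMap_apply, rotation_two_pi_sub hσ,
    conjTranspose_conjTranspose]
  congr 1
  set Z := hsAdjoint N (q * (rotation τ (phase l) * η * (rotation τ (phase l))ᴴ) * q)
  set U := rotation σ (phase j)
  calc retr (s * (U * H * Uᴴ) * s * Z) = retr ((s * U) * (H * Uᴴ * s * Z)) := by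
        simp only [mul_assoc]
    _ = retr (H * (Uᴴ * (s * Z * s) * U)) := by
        rw [retr_mul_comm]; simp only [mul_assoc]

lemma isUnit_of_posDef_mul_self {s : Matrix a a ℂ} (h : (s * s).PosDef) : IsUnit s :=
  isUnit_of_mul_isUnit_left h.isUnit

/-- The trace inequality behind the recovery bound. -/
lemma exp_retr_log_le {N : Matrix a a ℂ →ₗ[ℂ] Matrix b b ℂ} (hTP : IsTracePreserving N)
    (hN : IsTensorStablePositive N) {ρ : Matrix a a ℂ} (hρ : IsDensity ρ)
    {σ : Matrix a a ℂ} {τ : Matrix b b ℂ} (hσ : σ.IsHermitian) (hτ : τ.IsHermitian) (f g : ℝ → ℝ)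
    (hf : (cfc f σ * cfc f σ).PosDef) (hg : (cfc g τ * cfc g τ).PosDef)
    {H : Matrix a a ℂ} (hH : H.PosDef) {η : Matrix b b ℂ} (hη : η.PosDef) {m : ℝ}
    (hm : ∀ (φ : spectrum ℝ τ → ℝ) (θ : spectrum ℝ σ → ℝ),
      (∀ k, φ k ∈ Set.Icc 0 (2 * Real.pi)) → (∀ k, θ k ∈ Set.Icc 0 (2 * Real.pi)) →
      retr (H * petzMap (hsAdjoint N) (cfc f σ) (rotation σ θ) (cfc g τ) (rotation τ φ) η) ≤ m) :
    Real.exp (retr (ρ * (opLog H + opLog (cfc f σ * cfc f σ) - opLog ρ)) +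
      retr (N ρ * (opLog η + opLog (cfc g τ * cfc g τ)))) ≤ m := by
  set x := retr (ρ * (opLog H + opLog (cfc f σ * cfc f σ) - opLog ρ)) +
      retr (N ρ * (opLog η + opLog (cfc g τ * cfc g τ))) with hx
  set s := cfc f σ with hs
  set q := cfc g τ with hq
  have hN1 := hN.isPositiveMap
  have hsH : s.IsHermitian := cfc_isHermitian _ _
  have hqH : q.IsHermitian := cfc_isHermitian _ _
  have hNρ := isDensity_map hTP hN1 hρ
  set D := Fintype.card (spectrum ℝ σ) + Fintype.card (spectrum ℝ τ) with hD
  have key : ∀ n : ℕ, Real.exp x ^ n ≤ ((n : ℝ) + 1) ^ D * m ^ n := by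
    intro n
    have hHn := tpow_posDef (n := n) hH
    have hηn := tpow_posDef (n := n) hη
    have hssn := tpow_posDef (n := n) hf
    have hqqn := tpow_posDef (n := n) hg
    have hWle := le_twirl (n := n) hσ hHn.posSemidef.nonneg
    have hZle := le_twirl (n := n) hτ hηn.posSemidef.nonneg
    set W := twirl σ (tpow n H) with hW
    set Z := twirl τ (tpow n η) with hZ
    have hWp : W.PosDef := hHn.of_le hWle
    have hZp : Z.PosDef := hηn.of_le hZle
    have hWs : Commute W (tpow n s) := twirl_commute hσ f _
    have hZq : Commute Z (tpow n q) := twirl_commute hτ g _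
    have hWss : Commute W (tpow n (s * s)) := by rw [tpow_mul]; exact hWs.mul_right hWs
    have hZqq : Commute Z (tpow n (q * q)) := by rw [tpow_mul]; exact hZq.mul_right hZq
    have hX : tpow n s * W * tpow n s = W * tpow n (s * s) := by
      rw [← hWs.eq, mul_assoc, tpow_mul]
    have hY : tpow n q * Z * tpow n q = Z * tpow n (q * q) := by
      rw [← hZq.eq, mul_assoc, tpow_mul]
    have hXp : (tpow n s * W * tpow n s).PosDef := hX ▸ posDef_mul_of_commute hWp hssn hWss
    have hYp : (tpow n q * Z * tpow n q).PosDef := hY ▸ posDef_mul_of_commute hZp hqqn hZqq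
    set Ln := hsAdjoint (tensorPower n N) with hLn
    have hLpos : IsPositiveMap Ln := hsAdjoint_isPositiveMap (hN n)
    have hL1 : Ln 1 = 1 := hsAdjoint_tensorPower_one hTP
    have hLY := hLpos.map_posDef hL1 hYp
    have hρn := tpow_isDensity (n := n) hρ
    have hNρn := tpow_isDensity (n := n) hNρ
    have e1 : n * x = retr (tpow n ρ * (opLog (tpow n H) + opLog (tpow n (s * s)) -
        opLog (tpow n ρ))) + retr (tpow n (N ρ) * (opLog (tpow n η) + opLog (tpow n (q * q)))) := by
      simp only [hx, mul_sub, mul_add, map_sub, map_add]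
      rw [retr_tpow_mul_log_tpow hH hρ.1.1 hρ.2, retr_tpow_mul_log_tpow hf hρ.1.1 hρ.2,
        retr_tpow_mul_log_tpow_self hρ.1.1 hρ.2, retr_tpow_mul_log_tpow hη hNρ.1.1 hNρ.2,
        retr_tpow_mul_log_tpow hg hNρ.1.1 hNρ.2]
    have hlogH : opLog (tpow n H) ≤ opLog W := CFC.log_le_log hWle hHn.isStrictlyPositive
    have hlogη : opLog (tpow n η) ≤ opLog Z := CFC.log_le_log hZle hηn.isStrictlyPositive
    -- The output part is pulled back to the input space by duality, and operator Jensen moves the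
    -- adjoint of N^{⊗n} inside the logarithm.
    have e2 : retr (tpow n (N ρ) * (opLog (tpow n η) + opLog (tpow n (q * q)))) ≤
        retr (tpow n ρ * opLog (Ln (tpow n q * Z * tpow n q))) := by
      calc _ ≤ retr (tpow n (N ρ) * (opLog Z + opLog (tpow n (q * q)))) :=
            retr_mul_le_mul_left hNρn.1.nonneg (by gcongr)
        _ = retr (tpow n ρ * Ln (opLog (tpow n q * Z * tpow n q))) := by
            rw [hY, opLog_mul_of_commute hZp hqqn hZqq, hLn,
              retr_mul_hsAdjoint (hN n) hρn.1.nonneg, tensorPower_tpow]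
        _ ≤ _ := retr_mul_le_mul_left hρn.1.nonneg (hLpos.map_opLog_le hL1 hYp)
    have e3 : retr (tpow n ρ * (opLog (tpow n H) + opLog (tpow n (s * s)) - opLog (tpow n ρ))) ≤
        retr (tpow n ρ * (opLog (tpow n s * W * tpow n s) - opLog (tpow n ρ))) := by
      rw [hX, opLog_mul_of_commute hWp hssn hWss]
      exact retr_mul_le_mul_left hρn.1.nonneg (by gcongr)
    have e4 : n * x ≤ Real.log (retr (tpow n s * W * tpow n s *
        Ln (tpow n q * Z * tpow n q))) := by
      refine le_trans ?_ (retr_mul_log_add_log_sub_log_le hρn hXp hLY)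
      rw [e1]
      have h5 : retr (tpow n ρ * (opLog (tpow n s * W * tpow n s) +
          opLog (Ln (tpow n q * Z * tpow n q)) - opLog (tpow n ρ))) =
          retr (tpow n ρ * (opLog (tpow n s * W * tpow n s) - opLog (tpow n ρ))) +
          retr (tpow n ρ * opLog (Ln (tpow n q * Z * tpow n q))) := by
        simp only [mul_sub, mul_add, map_sub, map_add]
        ring
      rw [h5]
      exact add_le_add e3 e2
    have hpos : 0 < retr (tpow n s * W * tpow n s * Ln (tpow n q * Z * tpow n q)) := by
      refine retr_mul_pos hXp.posSemidef.nonneg (fun h0 => ?_) hLY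
      have hne : Nonempty (Fin n → a) := by
        by_contra h
        rw [not_nonempty_iff] at h
        have := hρn.2
        rw [Subsingleton.elim (tpow n ρ) 0] at this
        simp at this
      obtain ⟨i⟩ := hne
      rw [h0] at hXp
      simpa using hXp.diag_pos (i := i)
    rw [← Real.exp_nat_mul]
    refine ((Real.le_log_iff_exp_le hpos).1 e4).trans ?_
    rw [hW, hZ, hLn, sum_retr_pow hN1 hσ hsH hqH hH hη]
    calc _ ≤ ∑ j : spectrum ℝ σ → Fin (n + 1), ∑ l : spectrum ℝ τ → Fin (n + 1), m ^ n := by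
          refine Finset.sum_le_sum fun j _ => Finset.sum_le_sum fun l _ => ?_
          refine pow_le_pow_left₀ (retr_mul_nonneg hH.posSemidef.nonneg ?_) (hm _ _ ?_ ?_) n
          · rw [petzMap_apply]
            refine conj_nonneg ?_ _
            have h6 := conj_nonneg ((hsAdjoint_isPositiveMap hN1).map_nonneg
              (conj_nonneg (conj_nonneg hη.posSemidef.nonneg (rotation τ (phase l))) q)) s
            rwa [hsH.eq, hqH.eq] at h6
          · exact phase_mem l
          · intro k
            have := phase_mem j k
            constructor <;> linarith [this.1, this.2]
      _ = _ := by
          simp only [Finset.sum_const, Finset.card_univ, Fintype.card_fun, Fintype.card_fin,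
            nsmul_eq_mul, hD, pow_add]
          push_cast
          ring
  -- The case n = 1 bounds a positive number by a positive multiple of m.
  have hm0 : 0 < m := by
    have h1 := (Real.exp_pos x).trans_le (by simpa using key 1)
    exact (pos_iff_pos_of_mul_pos h1).1 (by positivity)
  exact le_of_forall_pow_le hm0 D key

/-! ### Supports -/

lemma cfc_posDef {A : Matrix a a ℂ} (hA : 0 ≤ A) {f : ℝ → ℝ} (hf : ∀ x, 0 ≤ x → 0 < f x) :
    (cfc f A).PosDef := by
  obtain ⟨U, d, hU, hU', rfl⟩ := hA.posSemidef.1.exists_diagonalization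
  have hd := (conj_diagonal_nonneg_iff hU d).1 hA
  rw [cfc_conj_diagonal hU, conj_diagonal_posDef_iff hU]
  exact fun i => hf _ (hd i)

lemma cfc_congr_nonneg {A : Matrix a a ℂ} (hA : 0 ≤ A) {f g : ℝ → ℝ}
    (h : ∀ x, 0 ≤ x → f x = g x) : cfc f A = cfc g A :=
  cfc_congr fun x hx => h x (spectrum_nonneg_of_nonneg hA hx)

lemma cfc_le_cfc {A : Matrix a a ℂ} (hA : 0 ≤ A) {f g : ℝ → ℝ} (h : ∀ x, 0 ≤ x → f x ≤ g x) :
    cfc f A ≤ cfc g A :=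
  cfc_mono (fun x hx => h x (spectrum_nonneg_of_nonneg hA hx))
    (A.finite_real_spectrum.continuousOn _) (A.finite_real_spectrum.continuousOn _)

lemma cfc_id_eq {A : Matrix a a ℂ} (hA : A.IsHermitian) : cfc (fun x : ℝ => x) A = A :=
  cfc_id' ℝ A hA

lemma cfc_one_eq {A : Matrix a a ℂ} (hA : A.IsHermitian) : cfc (fun _ : ℝ => (1 : ℝ)) A = 1 :=
  cfc_const_one ℝ A hA

/-- The projector onto the kernel. -/
noncomputable def kerProj (A : Matrix a a ℂ) : Matrix a a ℂ := eigenProj A 0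

lemma kerProj_eq (A : Matrix a a ℂ) :
    kerProj A = cfc (fun y : ℝ => if y = 0 then (1 : ℝ) else 0) A := rfl

lemma kerProj_isHermitian (A : Matrix a a ℂ) : (kerProj A).IsHermitian := cfc_isHermitian _ _

lemma kerProj_nonneg (A : Matrix a a ℂ) : 0 ≤ kerProj A :=
  cfc_nonneg fun x _ => by split_ifs <;> norm_num

lemma kerProj_le_one {A : Matrix a a ℂ} (hA : 0 ≤ A) : kerProj A ≤ 1 := by
  rw [← cfc_one_eq hA.posSemidef.1]
  exact cfc_le_cfc hA fun x _ => by split_ifs <;> norm_num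

lemma kerProj_mul_self {A : Matrix a a ℂ} (hA : A.IsHermitian) : kerProj A * A = 0 := by
  conv_lhs => rw [kerProj_eq]; rhs; rw [← cfc_id_eq hA]
  rw [cfc_mul_cfc, ← cfc_zero ℝ A]
  refine cfc_congr fun x _ => ?_
  by_cases h : x = 0 <;> simp [h]

lemma kerProj_mul_of_supp_le {A B : Matrix a a ℂ} (hA : A.IsHermitian) (h : supp B ≤ supp A) :
    kerProj A * B = 0 := by
  refine Matrix.ext_iff_mulVec.2 fun v => ?_
  have h1 : B.mulVecLin v ∈ supp A := h ⟨v, rfl⟩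
  obtain ⟨w, hw⟩ := h1
  rw [mulVecLin_apply, mulVecLin_apply] at hw
  rw [← mulVec_mulVec, ← hw, mulVec_mulVec, kerProj_mul_self hA]
  simp

lemma mul_cfc_inv_add_kerProj {A : Matrix a a ℂ} (hA : A.IsHermitian) :
    A * cfc (fun x : ℝ => x⁻¹) A + kerProj A = 1 := by
  conv_lhs => lhs; lhs; rw [← cfc_id_eq hA]
  rw [kerProj_eq, cfc_mul_cfc, cfc_add_cfc, ← cfc_one_eq hA]
  refine cfc_congr fun x _ => ?_
  by_cases h : x = 0 <;> simp [h]

lemma supp_le_iff {A B : Matrix a a ℂ} (hA : A.IsHermitian) :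
    supp B ≤ supp A ↔ kerProj A * B = 0 := by
  refine ⟨kerProj_mul_of_supp_le hA, fun h => ?_⟩
  rintro _ ⟨v, rfl⟩
  refine ⟨(cfc (fun x : ℝ => x⁻¹) A * B) *ᵥ v, ?_⟩
  rw [mulVecLin_apply, mulVecLin_apply, mulVec_mulVec, ← mul_assoc]
  have h1 := congr($(mul_cfc_inv_add_kerProj hA) * B)
  rw [add_mul, h, add_zero, one_mul] at h1
  rw [h1]

lemma opSqrt_mul_opInvSqrt_add {A : Matrix a a ℂ} (hA : 0 ≤ A) :
    opSqrt A * opInvSqrt A + kerProj A = 1 := by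
  rw [kerProj_eq, opSqrt, opInvSqrt, cfc_mul_cfc, cfc_add_cfc, ← cfc_one_eq hA.posSemidef.1]
  refine cfc_congr_nonneg hA fun x hx => ?_
  by_cases h : x = 0
  · simp [h]
  · have : √x ≠ 0 := (Real.sqrt_pos.2 (lt_of_le_of_ne hx (Ne.symm h))).ne'
    simp [h, this]

lemma opInvSqrt_isHermitian (A : Matrix a a ℂ) : (opInvSqrt A).IsHermitian := cfc_isHermitian _ _

lemma opInvSqrt_mul_mul {A : Matrix a a ℂ} (hA : 0 ≤ A) :
    opInvSqrt A * A * opInvSqrt A + kerProj A = 1 := by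
  conv_lhs => lhs; lhs; rhs; rw [← cfc_id_eq hA.posSemidef.1]
  rw [kerProj_eq, opInvSqrt, cfc_mul_cfc, cfc_mul_cfc, cfc_add_cfc, ← cfc_one_eq hA.posSemidef.1]
  refine cfc_congr_nonneg hA fun x hx => ?_
  by_cases h : x = 0
  · simp [h]
  · have h2 : √x ≠ 0 := (Real.sqrt_pos.2 (lt_of_le_of_ne hx (Ne.symm h))).ne'
    simp only [h, if_false, add_zero]
    field_simp
    exact (Real.sq_sqrt hx).symm

lemma mul_kerProj_of_kerProj_mul {A B : Matrix a a ℂ} (hB : B.IsHermitian)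
    (h : kerProj A * B = 0) : B * kerProj A = 0 := by
  have := congr($hᴴ)
  rwa [conjTranspose_mul, hB.eq, (kerProj_isHermitian A).eq, conjTranspose_zero] at this

/-- On the support B = √A (A^{-1/2} B A^{-1/2}) √A; the middle factor is at most a multiple of the
identity. -/
lemma exists_le_smul_of_supp_le {A B : Matrix a a ℂ} (hA : 0 ≤ A) (hB : 0 ≤ B)
    (h : kerProj A * B = 0) : ∃ C : ℝ, 0 < C ∧ B ≤ C • A := by
  have h' := mul_kerProj_of_kerProj_mul hB.posSemidef.1 h
  set S := opSqrt A with hS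
  set T := opInvSqrt A with hT
  have hSH : Sᴴ = S := opSqrt_isHermitian A
  have hTH : Tᴴ = T := opInvSqrt_isHermitian A
  have h1 : S * T + kerProj A = 1 := opSqrt_mul_opInvSqrt_add hA
  have h1' : T * S + kerProj A = 1 := by
    have := congr($h1ᴴ)
    rwa [conjTranspose_add, conjTranspose_mul, hSH, hTH, (kerProj_isHermitian A).eq,
      conjTranspose_one] at this
  have hTB : 0 ≤ T * B * Tᴴ := conj_nonneg hB T
  obtain ⟨C, hC, hle⟩ := hTB.posSemidef.1.exists_le_smul_one
  refine ⟨C, hC, ?_⟩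
  have h2 := conj_mono hle S
  have h3 : S * (T * B * Tᴴ) * Sᴴ = B := by
    have e1 : S * T * B = B := by
      have := congr($h1 * B)
      rwa [add_mul, h, add_zero, one_mul] at this
    have e2 : B * (T * S) = B := by
      have := congr(B * $h1')
      rwa [mul_add, h', add_zero, mul_one] at this
    rw [hTH, hSH]
    calc S * (T * B * T) * S = (S * T * B) * (T * S) := by simp only [mul_assoc]
      _ = B := by rw [e1, e2]
  rwa [h3, mul_smul_comm, smul_mul_assoc, mul_one, hSH, opSqrt_mul_self hA] at h2

/-- With P the kernel projector, PBP ≤ C·PAP = 0; writing B = X*X gives XP = 0. -/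
lemma kerProj_mul_of_le_smul {A B : Matrix a a ℂ} (hA : 0 ≤ A) (hB : 0 ≤ B) {C : ℝ}
    (h : B ≤ C • A) : kerProj A * B = 0 := by
  have h1 := conj_mono h (kerProj A)
  rw [mul_smul_comm, smul_mul_assoc, kerProj_mul_self hA.posSemidef.1, zero_mul, smul_zero] at h1
  have h2 := le_antisymm h1 (conj_nonneg hB _)
  obtain ⟨X, rfl⟩ := CStarAlgebra.nonneg_iff_eq_star_mul_self.mp hB
  have h3 : (X * (kerProj A)ᴴ)ᴴ * (X * (kerProj A)ᴴ) = 0 := by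
    rw [← h2, conjTranspose_mul, conjTranspose_conjTranspose, star_eq_conjTranspose]
    simp only [mul_assoc]
  rw [conjTranspose_mul_self_eq_zero] at h3
  have h4 := congr($h3ᴴ)
  rw [conjTranspose_mul, conjTranspose_conjTranspose, conjTranspose_zero] at h4
  rw [star_eq_conjTranspose, ← mul_assoc, h4, zero_mul]

/-- Inclusion of supports is domination up to a constant, which a positive map preserves. -/
lemma kerProj_map {N : Matrix a a ℂ →ₗ[ℂ] Matrix b b ℂ} (hN : IsPositiveMap N)
    {σ ρ : Matrix a a ℂ} (hσ : 0 ≤ σ) (hρ : 0 ≤ ρ) (h : kerProj σ * ρ = 0) :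
    kerProj (N σ) * N ρ = 0 := by
  obtain ⟨C, -, hC⟩ := exists_le_smul_of_supp_le hσ hρ h
  have h1 := hN.mono hC
  rw [map_real_smul] at h1
  exact kerProj_mul_of_le_smul (hN.map_nonneg hσ) (hN.map_nonneg hρ) h1

lemma rotation_conj_cfc {Y : Matrix a a ℂ} (hY : Y.IsHermitian) (θ : spectrum ℝ Y → ℝ)
    (f : ℝ → ℝ) : rotation Y θ * cfc f Y * (rotation Y θ)ᴴ = cfc f Y := by
  rw [(rotation_commute_cfc θ f).eq, mul_assoc, mul_eq_one_comm.1 (rotation_unitary hY θ), mul_one]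

lemma rotation_conj_self {Y : Matrix a a ℂ} (hY : Y.IsHermitian) (θ : spectrum ℝ Y → ℝ) :
    rotation Y θ * Y * (rotation Y θ)ᴴ = Y := by
  have := rotation_conj_cfc hY θ fun x => x
  rwa [cfc_id_eq hY] at this

/-! ### Regularisation on the kernel -/

/-- `A^{1/2}` with the eigenvalue `0` replaced by `r` (so that `r ^ 2` replaces `0` in `A`). -/
lemma cfc_sqrt_regularized (A : Matrix a a ℂ) (r : ℝ) :
    cfc (fun x : ℝ => if x = 0 then r else √x) A = opSqrt A + r • kerProj A := by
  rw [kerProj_eq, ← cfc_const_mul r _ A (A.finite_real_spectrum.continuousOn _), opSqrt,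
    cfc_add_cfc]
  refine cfc_congr fun x _ => ?_
  by_cases h : x = 0 <;> simp [h]

lemma cfc_inv_sqrt_regularized (A : Matrix a a ℂ) (r : ℝ) :
    cfc (fun x : ℝ => if x = 0 then r⁻¹ else (√x)⁻¹) A = opInvSqrt A + r⁻¹ • kerProj A := by
  rw [kerProj_eq, ← cfc_const_mul r⁻¹ _ A (A.finite_real_spectrum.continuousOn _), opInvSqrt,
    cfc_add_cfc]
  refine cfc_congr fun x _ => ?_
  by_cases h : x = 0 <;> simp [h]

/-- The dependence on r sits on the kernel alone, so it drops out when paired with a state supported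
in A. -/
lemma opLog_sqrt_regularized {A : Matrix a a ℂ} (hA : 0 ≤ A) {r : ℝ} :
    opLog (cfc (fun x : ℝ => if x = 0 then r else √x) A *
      cfc (fun x : ℝ => if x = 0 then r else √x) A) = opLog A + Real.log (r * r) • kerProj A := by
  rw [cfc_mul_cfc, opLog, opLog, cfc_cfc _ _ hA.posSemidef.1, kerProj_eq,
    ← cfc_const_mul (Real.log (r * r)) _ A (A.finite_real_spectrum.continuousOn _), cfc_add_cfc]
  refine cfc_congr_nonneg hA fun x hx => ?_
  by_cases h : x = 0
  · simp [h]
  · simp [h, Real.mul_self_sqrt hx]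

lemma opLog_inv_sqrt_regularized {A : Matrix a a ℂ} (hA : 0 ≤ A) {r : ℝ} :
    opLog (cfc (fun x : ℝ => if x = 0 then r⁻¹ else (√x)⁻¹) A *
      cfc (fun x : ℝ => if x = 0 then r⁻¹ else (√x)⁻¹) A) =
      Real.log (r⁻¹ * r⁻¹) • kerProj A - opLog A := by
  rw [cfc_mul_cfc, opLog, opLog, cfc_cfc _ _ hA.posSemidef.1, kerProj_eq,
    ← cfc_const_mul (Real.log (r⁻¹ * r⁻¹)) _ A (A.finite_real_spectrum.continuousOn _),
    ← cfc_sub _ _ A (A.finite_real_spectrum.continuousOn _)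
      (A.finite_real_spectrum.continuousOn _)]
  refine cfc_congr_nonneg hA fun x hx => ?_
  by_cases h : x = 0
  · simp [h]
  · simp only [h, if_false, mul_zero, zero_sub]
    rw [← mul_inv, Real.mul_self_sqrt hx, Real.log_inv]

/-- The sides differ by r(S − P)Z(S − P) ≥ 0, which absorbs the cross terms. -/
lemma conj_add_smul_le {S P Z : Matrix a a ℂ} (hS : S.IsHermitian) (hP : P.IsHermitian) (hZ : 0 ≤ Z)
    {r : ℝ} (hr : 0 ≤ r) :
    (S + r • P) * Z * (S + r • P) ≤ (1 + r) • (S * Z * S) + (r + r * r) • (P * Z * P) := by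
  have h1 : 0 ≤ r • ((S - P) * Z * (S - P)) := by
    have := conj_nonneg hZ (S - P)
    rw [conjTranspose_sub, hS.eq, hP.eq] at this
    exact smul_nonneg hr this
  have h2 : (1 + r) • (S * Z * S) + (r + r * r) • (P * Z * P) - (S + r • P) * Z * (S + r • P) =
      r • ((S - P) * Z * (S - P)) := by
    simp only [add_mul, mul_add, sub_mul, mul_sub, smul_mul_assoc, mul_smul_comm, smul_smul,
      add_smul, smul_add, smul_sub, one_smul]
    abel
  rw [← sub_nonneg, h2]
  exact h1

/-- By monotonicity of log, X may be lowered to c·1, which commutes with η; then x log x ≤ x log(x +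
c) on the spectrum, both sides being 0 at x = 0. -/
lemma retr_mul_log_le_retr_mul_log {η X : Matrix a a ℂ} (hη : 0 ≤ η) (hX : X.PosDef) :
    retr (η * opLog η) ≤ retr (η * opLog (η + X)) := by
  obtain ⟨c, hc, hle⟩ := hX.exists_smul_one_le
  have h1 : cfc (fun x : ℝ => x + c) η ≤ η + X := by
    have h0 : cfc (fun _ : ℝ => c) η = c • (1 : Matrix a a ℂ) := by
      rw [← Algebra.algebraMap_eq_smul_one]
      exact cfc_const c η hη.posSemidef.1
    rw [← cfc_add_cfc, cfc_id_eq hη.posSemidef.1, h0]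
    gcongr
  have hp : (cfc (fun x : ℝ => x + c) η).PosDef := cfc_posDef hη fun x hx => by positivity
  have h2 : opLog (cfc (fun x : ℝ => x + c) η) ≤ opLog (η + X) :=
    CFC.log_le_log h1 hp.isStrictlyPositive
  refine le_trans ?_ (retr_mul_le_mul_left hη h2)
  rw [opLog, opLog, cfc_cfc _ _ hη.posSemidef.1]
  conv_lhs => rw [show η * cfc Real.log η = cfc (fun x : ℝ => x) η * cfc Real.log η by
    rw [cfc_id_eq hη.posSemidef.1]]
  conv_rhs => rw [show η * cfc (fun x => Real.log (x + c)) η =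
    cfc (fun x : ℝ => x) η * cfc (fun x => Real.log (x + c)) η by rw [cfc_id_eq hη.posSemidef.1]]
  rw [cfc_mul_cfc, cfc_mul_cfc]
  refine retr_mono (cfc_le_cfc hη fun x hx => ?_)
  rcases hx.eq_or_lt with h0 | h0
  · simp [← h0]
  · gcongr
    linarith

/-- Since η does not see the kernel of N(σ), on η only the change of √σ matters, an error of order
r. The regularised N(σ) is sent exactly to the regularised σ, at most σ + r²·1. -/
lemma petzMap_regularized_le {N : Matrix a a ℂ →ₗ[ℂ] Matrix b b ℂ} (hTP : IsTracePreserving N)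
    (hN : IsPositiveMap N) {σ : Matrix a a ℂ} (hσ : 0 ≤ σ) {η : Matrix b b ℂ} (hη : 0 ≤ η)
    (hker : kerProj (N σ) * η = 0) {C : ℝ} (hC : 0 ≤ C) (hηC : η ≤ C • N σ) {r e : ℝ} (hr : 0 < r)
    (he : 0 ≤ e) (φ : spectrum ℝ (N σ) → ℝ) (θ : spectrum ℝ σ → ℝ) :
    petzMap (hsAdjoint N) (cfc (fun x : ℝ => if x = 0 then r else √x) σ) (rotation σ θ)
      (cfc (fun x : ℝ => if x = 0 then r⁻¹ else (√x)⁻¹) (N σ)) (rotation (N σ) φ)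
      (η + e • cfc (fun x : ℝ => if x = 0 then r * r else x) (N σ)) ≤
    (1 + r) • rotatedPetz σ N φ θ η + ((r + r * r) * C) • (1 : Matrix a a ℂ) +
      e • (σ + (r * r) • (1 : Matrix a a ℂ)) := by
  have hτ : 0 ≤ (N σ) := hN.map_nonneg hσ
  set L := hsAdjoint N with hL
  have hLpos : IsPositiveMap L := hsAdjoint_isPositiveMap hN
  have hL1 : L 1 = 1 := hsAdjoint_one hTP
  set U := rotation σ θ with hU
  set V := rotation (N σ) φ with hV
  have hUU : U * Uᴴ = 1 := mul_eq_one_comm.1 (rotation_unitary hσ.posSemidef.1 θ)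
  set P := kerProj σ with hP
  set Q := kerProj (N σ) with hQ
  set S := opSqrt σ with hS
  set T := opInvSqrt (N σ) with hT
  set s := cfc (fun x : ℝ => if x = 0 then r else √x) σ with hs
  set q := cfc (fun x : ℝ => if x = 0 then r⁻¹ else (√x)⁻¹) (N σ) with hq
  set τr := cfc (fun x : ℝ => if x = 0 then r * r else x) (N σ) with hτr
  have hsE : s = S + r • P := cfc_sqrt_regularized σ r
  have hqE : q = T + r⁻¹ • Q := cfc_inv_sqrt_regularized (N σ) r
  have hPH : Pᴴ = P := kerProj_isHermitian σ
  have hSH : Sᴴ = S := opSqrt_isHermitian σ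
  have hTH : Tᴴ = T := opInvSqrt_isHermitian (N σ)
  -- the part of the argument along `τr`
  have hqτq : q * τr * q = 1 := by
    rw [hq, hτr, cfc_mul_cfc, cfc_mul_cfc, ← cfc_one_eq hτ.posSemidef.1]
    refine cfc_congr_nonneg hτ fun x hx => ?_
    by_cases h : x = 0
    · simp only [h, if_true]
      field_simp
    · have h2 : √x ≠ 0 := (Real.sqrt_pos.2 (lt_of_le_of_ne hx (Ne.symm h))).ne'
      simp only [h, if_false]
      field_simp
      exact (Real.sq_sqrt hx).symm
  have hss : s * s ≤ σ + (r * r) • (1 : Matrix a a ℂ) := by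
    have h1 : s * s = σ + (r * r) • P := by
      rw [hs, cfc_mul_cfc, hP, kerProj_eq,
        ← cfc_const_mul (r * r) _ σ (σ.finite_real_spectrum.continuousOn _)]
      conv_rhs => lhs; rw [← cfc_id_eq hσ.posSemidef.1]
      rw [cfc_add_cfc]
      refine cfc_congr_nonneg hσ fun x hx => ?_
      by_cases h : x = 0
      · simp [h]
      · simp [h, Real.mul_self_sqrt hx]
    rw [h1]
    have := kerProj_le_one hσ
    gcongr
  have hssU : U * (s * s) * Uᴴ = s * s := by
    rw [hs, cfc_mul_cfc]
    exact rotation_conj_cfc hσ.posSemidef.1 θ _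
  -- the part of the argument along `η`
  have hQV : Q * V = V * Q := (rotation_commute_cfc φ _).eq.symm
  have hQη : Q * (V * η * Vᴴ) = 0 := by
    rw [← mul_assoc, ← mul_assoc, hQV, mul_assoc V, hker, mul_zero, zero_mul]
  have hηQ : (V * η * Vᴴ) * Q = 0 :=
    mul_kerProj_of_kerProj_mul (conj_nonneg hη V).posSemidef.1 hQη
  have hqηq : q * (V * η * Vᴴ) * q = T * (V * η * Vᴴ) * T := by
    rw [hqE, add_mul, smul_mul_assoc, hQη, smul_zero, add_zero, mul_add, mul_assoc T _ (r⁻¹ • Q),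
      mul_smul_comm, hηQ, smul_zero, mul_zero, add_zero]
  set Z := L (T * (V * η * Vᴴ) * T) with hZ
  have hZ0 : 0 ≤ Z := by
    have := conj_nonneg (conj_nonneg hη V) T
    rw [hTH] at this
    exact hLpos.map_nonneg this
  have hZC : Z ≤ C • (1 : Matrix a a ℂ) := by
    have h1 := conj_mono (conj_mono hηC V) T
    rw [mul_smul_comm, smul_mul_assoc, rotation_conj_self hτ.posSemidef.1, mul_smul_comm,
      smul_mul_assoc, hTH] at h1
    have h2 : T * (N σ) * T ≤ 1 := by
      rw [← opInvSqrt_mul_mul hτ]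
      exact le_add_of_nonneg_right (kerProj_nonneg (N σ))
    have h3 := hLpos.mono (h1.trans (smul_le_smul_of_nonneg_left h2 hC))
    rwa [map_real_smul, hL1] at h3
  have hsZs : s * Z * s ≤ (1 + r) • (S * Z * S) + ((r + r * r) * C) • (1 : Matrix a a ℂ) := by
    rw [hsE]
    refine (conj_add_smul_le hSH hPH hZ0 hr.le).trans ?_
    have h1 : P * Z * P ≤ C • (1 : Matrix a a ℂ) := by
      have h2 := conj_mono hZC P
      rw [mul_smul_comm, smul_mul_assoc, mul_one, hPH] at h2
      have h3 : P * P = P := by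
        rw [hP, kerProj_eq, cfc_mul_cfc]
        refine cfc_congr fun x _ => ?_
        by_cases h : x = 0 <;> simp [h]
      rw [h3] at h2
      exact h2.trans (smul_le_smul_of_nonneg_left (kerProj_le_one hσ) hC)
    rw [mul_smul]
    have h4 : 0 ≤ r + r * r := by positivity
    have := smul_le_smul_of_nonneg_left h1 h4
    gcongr
  have hE : petzMap L s U q V (η + e • τr) = U * (s * Z * s) * Uᴴ + e • (s * s) := by
    rw [map_add, map_real_smul, petzMap_apply, petzMap_apply, hqηq,
      rotation_conj_cfc hτ.posSemidef.1, hqτq, hL1, mul_one, hssU]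
  have hR : rotatedPetz σ N φ θ η = U * (S * Z * S) * Uᴴ := rfl
  rw [hE, hR]
  have h5 := conj_mono hsZs U
  rw [mul_add, add_mul, mul_smul_comm, mul_smul_comm, smul_mul_assoc, smul_mul_assoc, mul_one,
    hUU] at h5
  exact add_le_add h5 (smul_le_smul_of_nonneg_left hss he)

/-- The trace inequality, for arbitrary supports. -/
lemma exp_retr_log_sub_le {N : Matrix a a ℂ →ₗ[ℂ] Matrix b b ℂ} (hTP : IsTracePreserving N)
    (hN : IsTensorStablePositive N) {ρ σ : Matrix a a ℂ} (hσ : 0 ≤ σ) (hρ : IsDensity ρ)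
    (hker : kerProj σ * ρ = 0) {H : Matrix a a ℂ} (hH : H.PosDef) {m : ℝ}
    (hm : ∀ (φ : spectrum ℝ (N σ) → ℝ) (θ : spectrum ℝ σ → ℝ),
      (∀ k, φ k ∈ Set.Icc 0 (2 * Real.pi)) → (∀ k, θ k ∈ Set.Icc 0 (2 * Real.pi)) →
      retr (H * rotatedPetz σ N φ θ (N ρ)) ≤ m) :
    Real.exp (retr (ρ * opLog H) - (retr (ρ * (opLog ρ - opLog σ)) -
      retr (N ρ * (opLog (N ρ) - opLog (N σ))))) ≤ m := by
  have hN1 := hN.isPositiveMap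
  have hτ : 0 ≤ N σ := hN1.map_nonneg hσ
  have hη : 0 ≤ N ρ := hN1.map_nonneg hρ.1.nonneg
  have hkerη : kerProj (N σ) * N ρ = 0 := kerProj_map hN1 hσ hρ.1.nonneg hker
  obtain ⟨C, hC, hle⟩ := exists_le_smul_of_supp_le hτ hη hkerη
  have hρP : ρ * kerProj σ = 0 := mul_kerProj_of_kerProj_mul hρ.1.1 hker
  have hηQ : N ρ * kerProj (N σ) = 0 := mul_kerProj_of_kerProj_mul hη.posSemidef.1 hkerη
  -- The bound for Nρ perturbed by e = r times the regularised N(σ); it tends to m as r decreases to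
  -- 0.
  set F : ℝ → ℝ := fun r => (1 + r) * m + ((r + r * r) * C) * retr H +
    r * (retr (H * σ) + (r * r) * retr H) with hF
  have hbound : ∀ r : ℝ, 0 < r → Real.exp (retr (ρ * opLog H) -
      (retr (ρ * (opLog ρ - opLog σ)) - retr (N ρ * (opLog (N ρ) - opLog (N σ))))) ≤ F r := by
    intro r hr
    have hτr : (cfc (fun x : ℝ => if x = 0 then r * r else x) (N σ)).PosDef :=
      cfc_posDef hτ fun x hx => by
        split_ifs with h
        · positivity
        · exact lt_of_le_of_ne hx (Ne.symm h)
    have hfp : (cfc (fun x : ℝ => if x = 0 then r else √x) σ *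
        cfc (fun x : ℝ => if x = 0 then r else √x) σ).PosDef := by
      rw [cfc_mul_cfc]
      refine cfc_posDef hσ fun x hx => ?_
      split_ifs with h
      · positivity
      · have : 0 < √x := Real.sqrt_pos.2 (lt_of_le_of_ne hx (Ne.symm h))
        positivity
    have hgp : (cfc (fun x : ℝ => if x = 0 then r⁻¹ else (√x)⁻¹) (N σ) *
        cfc (fun x : ℝ => if x = 0 then r⁻¹ else (√x)⁻¹) (N σ)).PosDef := by
      rw [cfc_mul_cfc]
      refine cfc_posDef hτ fun x hx => ?_
      split_ifs with h
      · positivity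
      · have : 0 < √x := Real.sqrt_pos.2 (lt_of_le_of_ne hx (Ne.symm h))
        positivity
    have hrτ := hτr.smul hr
    have hη'p := PosDef.posSemidef_add hη.posSemidef hrτ
    refine le_trans (Real.exp_le_exp.2 ?_)
      (exp_retr_log_le hTP hN hρ hσ.posSemidef.1 hτ.posSemidef.1 _ _ hfp hgp hH hη'p ?_)
    · have h1 := retr_mul_log_le_retr_mul_log hη hrτ
      rw [opLog_sqrt_regularized hσ, opLog_inv_sqrt_regularized hτ]
      simp only [mul_sub, mul_add, map_sub, map_add, mul_smul_comm, hρP, hηQ, smul_zero, map_zero]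
      linarith
    · intro φ θ hφ hθ
      have h2 := retr_mul_le_mul_left hH.posSemidef.nonneg
        (petzMap_regularized_le hTP hN1 hσ hη hkerη hC.le hle hr hr.le φ θ)
      refine h2.trans ?_
      simp only [mul_add, map_add, mul_smul_comm, mul_one, map_smul, smul_eq_mul, hF]
      have h3 := mul_le_mul_of_nonneg_left (hm φ θ hφ hθ) (by positivity : 0 ≤ 1 + r)
      linarith
  have hcont : Continuous F := by
    rw [hF]
    fun_prop
  have htend : Filter.Tendsto F (nhdsWithin 0 (Set.Ioi 0)) (nhds m) := by
    have := (hcont.tendsto 0).mono_left (nhdsWithin_le_nhds (s := Set.Ioi 0))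
    simpa [hF] using this
  exact ge_of_tendsto htend (Filter.eventually_of_mem self_mem_nhdsWithin fun r hr => hbound r hr)

/-! ### Rotated Petz maps recover the reference operator -/

/-- Rotations fix σ and N(σ), and the adjoint is unital, so only N†(Q) could interfere, Q being the
kernel projector of N(σ). The positive operator √σ N†(Q) √σ has trace tr(N(σ)Q) = 0. -/
lemma rotatedPetz_self {N : Matrix a a ℂ →ₗ[ℂ] Matrix b b ℂ} (hTP : IsTracePreserving N)
    (hN : IsPositiveMap N) {σ : Matrix a a ℂ} (hσ : 0 ≤ σ) (φ : spectrum ℝ (N σ) → ℝ)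
    (θ : spectrum ℝ σ → ℝ) : rotatedPetz σ N φ θ (N σ) = σ := by
  have hτ : 0 ≤ N σ := hN.map_nonneg hσ
  have hLpos := hsAdjoint_isPositiveMap hN
  have hR : rotatedPetz σ N φ θ (N σ) = rotation σ θ * (opSqrt σ * hsAdjoint N (opInvSqrt (N σ) *
    (rotation (N σ) φ * N σ * (rotation (N σ) φ)ᴴ) * opInvSqrt (N σ)) * opSqrt σ) *
    (rotation σ θ)ᴴ := rfl
  have hSH : (opSqrt σ)ᴴ = opSqrt σ := opSqrt_isHermitian σ
  have h1 : opInvSqrt (N σ) * N σ * opInvSqrt (N σ) = 1 - kerProj (N σ) :=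
    eq_sub_of_add_eq (opInvSqrt_mul_mul hτ)
  have h2 : opSqrt σ * hsAdjoint N (kerProj (N σ)) * opSqrt σ = 0 := by
    have h3 := conj_nonneg (hLpos.map_nonneg (kerProj_nonneg (N σ))) (opSqrt σ)
    rw [hSH] at h3
    refine eq_zero_of_retr_eq_zero h3 ?_
    rw [retr_mul_comm, ← mul_assoc, opSqrt_mul_self hσ, retr_mul_hsAdjoint hN hσ, retr_mul_comm,
      kerProj_mul_self hτ.posSemidef.1, map_zero]
  rw [hR, rotation_conj_self hτ.posSemidef.1, h1, map_sub, hsAdjoint_one hTP, mul_sub, sub_mul, h2,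
    sub_zero, mul_one, opSqrt_mul_self hσ, rotation_conj_self hσ.posSemidef.1]

lemma apply_self_of_mem_rotatedPetzHull {N : Matrix a a ℂ →ₗ[ℂ] Matrix b b ℂ}
    (hTP : IsTracePreserving N) (hN : IsPositiveMap N) {σ : Matrix a a ℂ} (hσ : 0 ≤ σ)
    {R : Matrix b b ℂ →ₗ[ℂ] Matrix a a ℂ} (hR : R ∈ rotatedPetzHull σ N) : R (N σ) = σ := by
  have hconv : Convex ℝ {R : Matrix b b ℂ →ₗ[ℂ] Matrix a a ℂ | R (N σ) = σ} := by
    intro R₁ h₁ R₂ h₂ x y _ _ hxy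
    simp only [Set.mem_ofPred_eq] at h₁ h₂ ⊢
    rw [LinearMap.add_apply, LinearMap.smul_apply, LinearMap.smul_apply, h₁, h₂, ← add_smul, hxy,
      one_smul]
  refine convexHull_min ?_ hconv hR
  rintro _ ⟨φ, θ, -, -, rfl⟩
  exact rotatedPetz_self hTP hN hσ φ θ

/-! ### A minimax argument -/

lemma sum_eq_sum_embedding {ι κ M : Type*} [Fintype ι] [Fintype κ] [AddCommMonoid M] (e : ι ↪ κ)
    (g : κ → M) (h : ∀ i, i ∉ Set.range e → g i = 0) : ∑ i, g i = ∑ i, g (e i) := by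
  classical
  rw [← Finset.sum_map Finset.univ e g]
  refine (Finset.sum_subset (Finset.subset_univ _) fun i _ hi => h i ?_).symm
  simpa using hi

/-- By Carathéodory, dim + 1 points suffice, so the hull is a continuous image of a simplex times a
power of s. -/
lemma isCompact_convexHull_of_isCompact {E : Type*} [NormedAddCommGroup E] [NormedSpace ℝ E]
    [FiniteDimensional ℝ E] {s : Set E} (hs : IsCompact s) : IsCompact (convexHull ℝ s) := by
  rcases s.eq_empty_or_nonempty with rfl | ⟨x₀, hx₀⟩
  · simp
  set d := Module.finrank ℝ E + 1 with hd
  set F : (Fin d → ℝ) × (Fin d → E) → E := fun p => ∑ i, p.1 i • p.2 i with hF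
  have hFc : Continuous F := by rw [hF]; fun_prop
  have hK : IsCompact (stdSimplex ℝ (Fin d) ×ˢ Set.univ.pi fun _ : Fin d => s) :=
    (isCompact_stdSimplex ℝ (Fin d)).prod (isCompact_univ_pi fun _ => hs)
  convert hK.image hFc
  refine Set.Subset.antisymm ?_ ?_
  · intro x hx
    obtain ⟨ι, hι, z, w, hz, hind, hw, hw1, rfl⟩ := eq_pos_convex_span_of_mem_convexHull hx
    have hcard : Fintype.card ι ≤ Fintype.card (Fin d) := by
      rw [Fintype.card_fin]
      exact hind.card_le_finrank_succ.trans (Nat.succ_le_succ (Submodule.finrank_le _))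
    obtain ⟨e⟩ := Function.Embedding.nonempty_of_card_le hcard
    -- Shorter combinations are padded with weight zero at `x₀`.
    refine ⟨(Function.extend e w 0, Function.extend e z fun _ => x₀), ⟨⟨fun i => ?_, ?_⟩, ?_⟩, ?_⟩
    · by_cases hi : ∃ j, e j = i
      · obtain ⟨j, rfl⟩ := hi
        simp only [e.injective.extend_apply]
        exact (hw j).le
      · simp only [Function.extend_apply' _ _ _ hi]
        exact le_rfl
    · rw [sum_eq_sum_embedding e _ fun i hi => Function.extend_apply' w (0 : Fin d → ℝ) i hi]
      simp only [e.injective.extend_apply]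
      exact hw1
    · intro i _
      by_cases hi : ∃ j, e j = i
      · obtain ⟨j, rfl⟩ := hi
        simp only [e.injective.extend_apply]
        exact hz ⟨j, rfl⟩
      · simp only [Function.extend_apply' _ _ _ hi]
        exact hx₀
    · simp only [hF]
      rw [sum_eq_sum_embedding e _ fun i hi => ?_]
      · simp only [e.injective.extend_apply]
      · rw [Function.extend_apply' _ _ _ hi, Pi.zero_apply, zero_smul]
  · rintro _ ⟨⟨w, z⟩, ⟨⟨hw, hw1⟩, hz⟩, rfl⟩
    exact (convex_convexHull ℝ s).sum_mem (fun i _ => hw i) hw1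
      fun i _ => subset_convexHull ℝ s (hz i (Set.mem_univ i))

/-- A finite-dimensional minimax principle. -/
lemma exists_forall_le_of_forall_convex_combination {E I : Type*} [NormedAddCommGroup E]
    [NormedSpace ℝ E] [FiniteDimensional ℝ E] {K : Set E} (hK : IsCompact K) (hKc : Convex ℝ K)
    (ℓ : I → E →ₗ[ℝ] ℝ) (g : I → ℝ)
    (h : ∀ (t : Finset I) (w : I → ℝ), (∀ i ∈ t, 0 ≤ w i) → ∑ i ∈ t, w i = 1 →
      ∃ x ∈ K, ∑ i ∈ t, w i * g i ≤ ∑ i ∈ t, w i * ℓ i x) (hKne : K.Nonempty) :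
    ∃ x ∈ K, ∀ i, g i ≤ ℓ i x := by
  classical
  have hcont (i : I) : Continuous (ℓ i) := (ℓ i).continuous_of_finiteDimensional
  have hfin : (K ∩ ⋂ i, {x | g i ≤ ℓ i x}).Nonempty := by
    refine hK.inter_iInter_nonempty _ (fun i => isClosed_le continuous_const (hcont i)) fun t => ?_
    by_contra hemp
    set Φ : E → (t → ℝ) := fun x i => ℓ i x - g i with hΦ
    have hΦc : Continuous Φ := continuous_pi fun i => (hcont i).sub continuous_const
    have hA : Convex ℝ (Φ '' K) := by
      rintro _ ⟨x, hx, rfl⟩ _ ⟨y, hy, rfl⟩ α β hα hβ hαβ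
      refine ⟨α • x + β • y, hKc hx hy hα hβ hαβ, ?_⟩
      ext i
      simp only [hΦ, map_add, map_smul, smul_eq_mul, Pi.add_apply, Pi.smul_apply]
      linear_combination (g i) * hαβ
    -- By compactness finitely many constraints suffice. If they cannot be met together, a
    -- functional separates the image of K from the orthant; its normalised coefficients are weights
    -- contradicting `h`.
    have hdisj : Disjoint (Φ '' K) (Set.Ici (0 : t → ℝ)) := by
      rw [Set.disjoint_left]
      rintro _ ⟨x, hx, rfl⟩ hpos
      refine hemp ⟨x, hx, Set.mem_iInter₂.2 fun i hi => ?_⟩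
      exact sub_nonneg.1 (hpos ⟨i, hi⟩)
    obtain ⟨f, u, v, hfu, huv, hfv⟩ := geometric_hahn_banach_compact_closed hA (hK.image hΦc)
      (convex_Ici 0) isClosed_Ici hdisj
    have hv0 : v < 0 := by simpa using hfv 0 (le_refl (0 : t → ℝ))
    have hw (i : t) : 0 ≤ f (Pi.single i 1) := by
      by_contra! hneg
      -- If the coefficient were negative, this orthant point would have value exactly v, against
      -- strict separation.
      have h1 := hfv (Pi.single i (v / f (Pi.single i 1))) (by
        intro j
        by_cases hj : j = i
        · subst hj
          simpa using (div_pos_of_neg_of_neg hv0 hneg).le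
        · simp [hj])
      have h2 : (Pi.single i (v / f (Pi.single i 1)) : t → ℝ) =
          (v / f (Pi.single i 1)) • Pi.single i (1 : ℝ) := by
        rw [← Pi.single_smul]
        simp
      rw [h2, map_smul, smul_eq_mul, div_mul_cancel₀ _ hneg.ne] at h1
      exact lt_irrefl _ h1
    have hf (y : t → ℝ) : f y = ∑ i, f (Pi.single i 1) * y i := by
      conv_lhs => rw [pi_eq_sum_univ' y]
      rw [map_sum]
      refine Finset.sum_congr rfl fun i _ => ?_
      rw [map_smul, smul_eq_mul, mul_comm]
    obtain ⟨x₀, hx₀⟩ := hKne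
    have hneg (x : E) (hx : x ∈ K) : f (Φ x) < 0 := (hfu _ ⟨x, hx, rfl⟩).trans (huv.trans hv0)
    set W := ∑ i : t, f (Pi.single i 1) with hW
    have hWpos : 0 < W := by
      refine (Finset.sum_nonneg fun i _ => hw i).lt_of_ne' fun h0 => ?_
      have h1 := (Finset.sum_eq_zero_iff_of_nonneg fun i _ => hw i).1 h0
      have h2 := hneg x₀ hx₀
      rw [hf, Finset.sum_eq_zero fun i hi => by rw [h1 i hi, zero_mul]] at h2
      exact lt_irrefl _ h2
    set w : I → ℝ := fun i => if hi : i ∈ t then f (Pi.single ⟨i, hi⟩ 1) / W else 0 with hwdef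
    have hwt (i : t) : w i = f (Pi.single i 1) / W := by simp [hwdef]
    obtain ⟨x, hx, hle⟩ := h t w (fun i hi => by
      rw [hwt ⟨i, hi⟩]; exact div_nonneg (hw _) hWpos.le) (by
      rw [← Finset.sum_coe_sort t w]
      simp only [hwt]
      rw [← Finset.sum_div, ← hW, div_self hWpos.ne'])
    have h3 := hneg x hx
    rw [hf] at h3
    have h4 : ∑ i : t, f (Pi.single i 1) * Φ x i =
        W * (∑ i ∈ t, w i * ℓ i x - ∑ i ∈ t, w i * g i) := by
      rw [← Finset.sum_coe_sort t fun i => w i * ℓ i x,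
        ← Finset.sum_coe_sort t fun i => w i * g i, ← Finset.sum_sub_distrib, Finset.mul_sum]
      refine Finset.sum_congr rfl fun i _ => ?_
      rw [hwt]
      simp only [hΦ]
      field_simp
    rw [h4] at h3
    have := mul_nonneg hWpos.le (sub_nonneg.2 hle)
    linarith
  obtain ⟨x, hx, hx'⟩ := hfin
  exact ⟨x, hx, fun i => Set.mem_iInter.1 hx' i⟩

/-! ### Compactness of the recovered operators and choice of one recovery map -/

lemma continuous_rotation (Y : Matrix a a ℂ) : Continuous (rotation Y) := by
  have : rotation Y = fun θ : spectrum ℝ Y → ℝ => ∑ k : spectrum ℝ Y,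
      Complex.exp (Complex.I * (θ k : ℂ)) • eigenProj Y (k : ℝ) := by
    ext1 θ
    rw [rotation, finsum_eq_sum_of_fintype]
  rw [this]
  fun_prop

lemma continuous_rotatedPetz (σ : Matrix a a ℂ) (N : Matrix a a ℂ →ₗ[ℂ] Matrix b b ℂ)
    (X : Matrix b b ℂ) : Continuous fun p : (spectrum ℝ (N σ) → ℝ) × (spectrum ℝ σ → ℝ) =>
      rotatedPetz σ N p.1 p.2 X := by
  have hL : Continuous (hsAdjoint N) :=
    ((hsAdjoint N).restrictScalars ℝ).continuous_of_finiteDimensional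
  have h1 : Continuous fun p : (spectrum ℝ (N σ) → ℝ) × (spectrum ℝ σ → ℝ) =>
      rotation (N σ) p.1 := (continuous_rotation (N σ)).comp continuous_fst
  have h2 : Continuous fun p : (spectrum ℝ (N σ) → ℝ) × (spectrum ℝ σ → ℝ) =>
      rotation σ p.2 := (continuous_rotation σ).comp continuous_snd
  have h3 : ∀ p : (spectrum ℝ (N σ) → ℝ) × (spectrum ℝ σ → ℝ), rotatedPetz σ N p.1 p.2 X =
      rotation σ p.2 * (opSqrt σ * hsAdjoint N (opInvSqrt (N σ) *
      (rotation (N σ) p.1 * X * star (rotation (N σ) p.1)) * opInvSqrt (N σ)) * opSqrt σ) *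
      star (rotation σ p.2) := fun p => rfl
  simp only [h3]
  refine (h2.mul ((continuous_const.mul (hL.comp ?_)).mul continuous_const)).mul h2.star
  exact (continuous_const.mul ((h1.mul continuous_const).mul h1.star)).mul continuous_const

/-- One recovery map in the convex hull satisfies the variational bound for all test operators. -/
lemma exists_mem_rotatedPetzHull {N : Matrix a a ℂ →ₗ[ℂ] Matrix b b ℂ} (hTP : IsTracePreserving N)
    (hN : IsTensorStablePositive N) {ρ σ : Matrix a a ℂ} (hσ : 0 ≤ σ) (hρ : IsDensity ρ)
    (hker : kerProj σ * ρ = 0) :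
    ∃ R ∈ rotatedPetzHull σ N, ∀ H : Matrix a a ℂ, H.PosDef →
      retr (ρ * opLog H) - (retr (ρ * (opLog ρ - opLog σ)) -
        retr (N ρ * (opLog (N ρ) - opLog (N σ)))) + 1 ≤ retr (H * R (N ρ)) := by
  set c := retr (ρ * (opLog ρ - opLog σ)) - retr (N ρ * (opLog (N ρ) - opLog (N σ))) with hc
  set T : Set (Matrix b b ℂ →ₗ[ℂ] Matrix a a ℂ) :=
    {T | ∃ (φ : spectrum ℝ (N σ) → ℝ) (θ : spectrum ℝ σ → ℝ),
    (∀ k, φ k ∈ Set.Icc 0 (2 * Real.pi)) ∧ (∀ k, θ k ∈ Set.Icc 0 (2 * Real.pi)) ∧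
      T = rotatedPetz σ N φ θ} with hT
  set ev : (Matrix b b ℂ →ₗ[ℂ] Matrix a a ℂ) →ₗ[ℝ] Matrix a a ℂ :=
    (LinearMap.applyₗ (R := ℂ) (N ρ)).restrictScalars ℝ with hev
  have hev' (R : Matrix b b ℂ →ₗ[ℂ] Matrix a a ℂ) : ev R = R (N ρ) := rfl
  have hTc : IsCompact (ev '' T) := by
    have h1 : IsCompact ((Set.univ.pi fun _ : spectrum ℝ (N σ) => Set.Icc 0 (2 * Real.pi)) ×ˢ
        (Set.univ.pi fun _ : spectrum ℝ σ => Set.Icc 0 (2 * Real.pi))) :=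
      (isCompact_univ_pi fun _ => isCompact_Icc).prod (isCompact_univ_pi fun _ => isCompact_Icc)
    convert h1.image (continuous_rotatedPetz σ N (N ρ))
    ext X
    constructor
    · rintro ⟨_, ⟨φ, θ, hφ, hθ, rfl⟩, rfl⟩
      exact ⟨(φ, θ), ⟨fun k _ => hφ k, fun k _ => hθ k⟩, rfl⟩
    · rintro ⟨⟨φ, θ⟩, ⟨hφ, hθ⟩, rfl⟩
      exact ⟨_, ⟨φ, θ, fun k => hφ k (Set.mem_univ k), fun k => hθ k (Set.mem_univ k), rfl⟩, rfl⟩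
  have hTne : (ev '' T).Nonempty := by
    refine ⟨_, ⟨_, ⟨fun _ => 0, fun _ => 0, ?_, ?_, rfl⟩, rfl⟩⟩ <;>
    · intro k
      exact ⟨le_rfl, Real.two_pi_pos.le⟩
  set K := convexHull ℝ (ev '' T) with hK
  have hKc : IsCompact K := isCompact_convexHull_of_isCompact hTc
  have hKne : K.Nonempty := hTne.mono (subset_convexHull ℝ _)
  let ℓ (H : Matrix a a ℂ) : Matrix a a ℂ →ₗ[ℝ] ℝ := retr ∘ₗ LinearMap.mulLeft ℝ H
  have hℓ (H X : Matrix a a ℂ) : ℓ H X = retr (H * X) := rfl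
  have hsingle (H : Matrix a a ℂ) (hH : H.PosDef) : ∃ X ∈ K, retr (ρ * opLog H) - c + 1 ≤ ℓ H X := by
    obtain ⟨X, hX, hmax⟩ := hKc.exists_isMaxOn hKne
      ((ℓ H).continuous_of_finiteDimensional.continuousOn)
    refine ⟨X, hX, ?_⟩
    -- Linearising the exponential leaves a bound concave in H, as the minimax principle needs.
    refine (Real.add_one_le_exp _).trans ?_
    refine exp_retr_log_sub_le hTP hN hσ hρ hker hH fun φ θ hφ hθ => ?_
    exact hmax (subset_convexHull ℝ _ ⟨_, ⟨φ, θ, hφ, hθ, rfl⟩, rfl⟩)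
  obtain ⟨X, hX, hall⟩ := exists_forall_le_of_forall_convex_combination
    (I := {H : Matrix a a ℂ // H.PosDef}) hKc (convex_convexHull ℝ _) (fun H => ℓ H)
    -- A convex combination of tests is dominated by the single test at the averaged H, by operator
    -- concavity of log.
    (fun H => retr (ρ * opLog H) - c + 1) (fun t w hw hw1 => by
      have hconc := (CFC.concaveOn_log (A := Matrix a a ℂ)).le_map_sum (t := t) (w := w)
        (p := fun H => (H : Matrix a a ℂ)) hw hw1 fun H _ => H.2.isStrictlyPositive
      have hmem := (CFC.concaveOn_log (A := Matrix a a ℂ)).1.sum_mem (t := t) (w := w)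
        (z := fun H => (H : Matrix a a ℂ)) hw hw1 fun H _ => H.2.isStrictlyPositive
      obtain ⟨X, hX, hle⟩ := hsingle _ (IsStrictlyPositive.posDef hmem)
      refine ⟨X, hX, ?_⟩
      have h1 := retr_mul_le_mul_left hρ.1.nonneg hconc
      simp only [hℓ, Finset.sum_mul, map_sum, Finset.mul_sum, mul_smul_comm, smul_mul_assoc,
        map_smul, smul_eq_mul] at h1 hle ⊢
      refine le_trans ?_ hle
      have h2 : ∑ i ∈ t, w i * (retr (ρ * opLog i) - c + 1) =
          ∑ i ∈ t, w i * retr (ρ * opLog i) - c + 1 := by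
        simp only [mul_add, mul_sub, Finset.sum_add_distrib, Finset.sum_sub_distrib,
          ← Finset.sum_mul, hw1]
        ring
      rw [h2]
      have h3 : ∑ i ∈ t, w i * retr (ρ * opLog i) ≤
        retr (ρ * opLog (∑ i ∈ t, w i • (i : Matrix a a ℂ))) := h1
      linarith) hKne
  have himg : K = ev '' (rotatedPetzHull σ N) := (LinearMap.image_convexHull ev T).symm
  rw [himg] at hX
  obtain ⟨R, hR, rfl⟩ := hX
  exact ⟨R, hR, fun H hH => hall ⟨H, hH⟩⟩

lemma map_nonneg_of_mem_rotatedPetzHull {N : Matrix a a ℂ →ₗ[ℂ] Matrix b b ℂ}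
    (hN : IsPositiveMap N) {σ : Matrix a a ℂ}
    {R : Matrix b b ℂ →ₗ[ℂ] Matrix a a ℂ} (hR : R ∈ rotatedPetzHull σ N) {X : Matrix b b ℂ}
    (hX : 0 ≤ X) : 0 ≤ R X := by
  have hconv : Convex ℝ {R : Matrix b b ℂ →ₗ[ℂ] Matrix a a ℂ | 0 ≤ R X} := by
    intro R₁ h₁ R₂ h₂ x y hx hy _
    simp only [Set.mem_ofPred_eq] at h₁ h₂ ⊢
    rw [LinearMap.add_apply, LinearMap.smul_apply, LinearMap.smul_apply]
    exact add_nonneg (smul_nonneg hx h₁) (smul_nonneg hy h₂)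
  refine convexHull_min ?_ hconv hR
  rintro _ ⟨φ, θ, -, -, rfl⟩
  have h1 := conj_nonneg (conj_nonneg hX (rotation (N σ) φ)) (opInvSqrt (N σ))
  rw [(opInvSqrt_isHermitian (N σ)).eq] at h1
  have h2 := conj_nonneg ((hsAdjoint_isPositiveMap hN).map_nonneg h1) (opSqrt σ)
  rw [(opSqrt_isHermitian σ).eq] at h2
  exact conj_nonneg h2 (rotation σ θ)

/-! ### Measured relative entropy: upper bound -/

lemma cfc_diagonal (d : a → ℝ) (f : ℝ → ℝ) :
    cfc f (diagonal (fun i => (d i : ℂ))) = diagonal (fun i => (f (d i) : ℂ)) := by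
  have := cfc_conj_diagonal (U := (1 : Matrix a a ℂ)) (by simp) d f
  simpa using this

lemma relEntropy_diagonal (p q : a → ℝ) :
    ((∀ x, q x = 0 → p x = 0) →
      relEntropy (diagonal fun x => (p x : ℂ)) (diagonal fun x => (q x : ℂ)) =
        ((∑ x, p x * (Real.log (p x) - Real.log (q x)) : ℝ) : EReal)) ∧
    (¬(∀ x, q x = 0 → p x = 0) →
      relEntropy (diagonal fun x => (p x : ℂ)) (diagonal fun x => (q x : ℂ)) = ⊤) := by
  have hq : (diagonal fun x => (q x : ℂ)).IsHermitian := by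
    rw [IsHermitian, diagonal_conjTranspose]
    congr 1
    ext x
    simp
  have hiff : supp (diagonal fun x => (p x : ℂ)) ≤ supp (diagonal fun x => (q x : ℂ)) ↔
      ∀ x, q x = 0 → p x = 0 := by
    rw [supp_le_iff hq, kerProj_eq, cfc_diagonal, diagonal_mul_diagonal, ← diagonal_zero,
      diagonal_eq_diagonal_iff]
    refine forall_congr' fun x => ?_
    by_cases h : q x = 0 <;> simp [h]
  constructor
  · intro h
    rw [relEntropy, if_pos (hiff.2 h), opLog, opLog, cfc_diagonal, cfc_diagonal, diagonal_sub,
      diagonal_mul_diagonal, trace_diagonal]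
    congr 1
    simp only [← Complex.ofReal_sub, ← Complex.ofReal_mul, ← Complex.ofReal_sum, Complex.ofReal_re]
  · intro h
    rw [relEntropy, if_neg fun h' => h (hiff.1 h')]

lemma IsProjMeasurement.nonneg {n : ℕ} {M : Fin n → Matrix a a ℂ} (hM : IsProjMeasurement M)
    (x : Fin n) : 0 ≤ M x := by
  have := (posSemidef_conjTranspose_mul_self (M x)).nonneg
  rwa [(hM.1 x).1.eq, (hM.1 x).2] at this

lemma measure_eq_diagonal {n : ℕ} {M : Fin n → Matrix a a ℂ} (hM : IsProjMeasurement M)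
    {ρ : Matrix a a ℂ} (hρ : ρ.IsHermitian) :
    measure M ρ = diagonal fun x => (retr (ρ * M x) : ℂ) := by
  rw [measure]
  congr 1
  ext x
  exact trace_mul_eq_retr hρ (hM.1 x).1

/-- The positive unital map from diagonal operators given by a resolution of the identity. -/
noncomputable def povmMap {n : ℕ} (M : Fin n → Matrix a a ℂ) :
    Matrix (Fin n) (Fin n) ℂ →ₗ[ℂ] Matrix a a ℂ where
  toFun X := ∑ x, X x x • M x
  map_add' X Y := by simp [add_smul, Finset.sum_add_distrib]
  map_smul' c X := by simp [mul_smul, Finset.smul_sum]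

lemma povmMap_apply {n : ℕ} (M : Fin n → Matrix a a ℂ) (X : Matrix (Fin n) (Fin n) ℂ) :
    povmMap M X = ∑ x, X x x • M x := rfl

lemma povmMap_isPositiveMap {n : ℕ} {M : Fin n → Matrix a a ℂ} (hM : ∀ x, 0 ≤ M x) :
    IsPositiveMap (povmMap M) := by
  intro X hX
  rw [povmMap_apply]
  refine posSemidef_sum _ fun x _ => ?_
  exact (hM x).posSemidef.smul hX.diag_nonneg

lemma povmMap_one {n : ℕ} {M : Fin n → Matrix a a ℂ} (hM : ∑ x, M x = 1) : povmMap M 1 = 1 := by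
  simp [povmMap_apply, hM]

lemma povmMap_diagonal {n : ℕ} (M : Fin n → Matrix a a ℂ) (y : Fin n → ℝ) :
    povmMap M (diagonal fun x => (y x : ℂ)) = ∑ x, y x • M x := by
  simp [povmMap_apply]

/-- The converse half of the variational formula for relative entropy: the optimal test function is
y = p/q, approximated by positive ones. -/
lemma sum_mul_log_sub_log_le_of_forall {ι : Type*} [Fintype ι] {p q : ι → ℝ} {c : ℝ}
    (hp : ∀ x, 0 ≤ p x) (hp1 : ∑ x, p x = 1) (hq : ∀ x, 0 ≤ q x)
    (h : ∀ y : ι → ℝ, (∀ x, 0 < y x) →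
      ∑ x, p x * Real.log (y x) - c + 1 ≤ ∑ x, y x * q x) :
    (∀ x, q x = 0 → p x = 0) ∧ ∑ x, p x * (Real.log (p x) - Real.log (q x)) ≤ c := by
  classical
  have h0 : ∀ x, q x = 0 → p x = 0 := by
    intro x₀ hq0
    by_contra hne
    -- A value of y at `x₀` costs nothing on the right; this one makes the hypothesis read ∑ q + 1 ≤
    -- ∑ q.
    have hy := h (fun x => if x = x₀ then Real.exp ((∑ x, q x + c) / p x₀) else 1) fun x => by
      split_ifs <;> positivity
    have h1 : ∑ x, p x * Real.log (if x = x₀ then Real.exp ((∑ x, q x + c) / p x₀) else 1) =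
        ∑ x, q x + c := by
      rw [Finset.sum_eq_single x₀]
      · rw [if_pos rfl, Real.log_exp, mul_div_cancel₀ _ hne]
      · intro x _ hx
        simp [hx]
      · simp
    have h2 : ∑ x, (if x = x₀ then Real.exp ((∑ x, q x + c) / p x₀) else 1) * q x = ∑ x, q x := by
      refine Finset.sum_congr rfl fun x _ => ?_
      by_cases hx : x = x₀
      · subst hx; simp [hq0]
      · simp [hx]
    simp only [h1, h2] at hy
    linarith
  refine ⟨h0, le_of_forall_pos_le_add fun ε hε => ?_⟩
  have hQ : 0 ≤ ∑ x, q x := Finset.sum_nonneg fun x _ => hq x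
  -- Where p = 0 the optimal y would be 0; the positive substitute δ costs at most ε in total.
  set δ := ε / (∑ x, q x + 1) with hδ
  have hδ0 : 0 < δ := by positivity
  have hqpos : ∀ x, p x ≠ 0 → 0 < q x := fun x hx =>
    lt_of_le_of_ne (hq x) fun h' => hx (h0 x h'.symm)
  have hy := h (fun x => if p x = 0 then δ else p x / q x) fun x => by
    split_ifs with hx
    · exact hδ0
    · exact div_pos (lt_of_le_of_ne (hp x) (Ne.symm hx)) (hqpos x hx)
  have h1 : ∑ x, p x * Real.log (if p x = 0 then δ else p x / q x) =
      ∑ x, p x * (Real.log (p x) - Real.log (q x)) := by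
    refine Finset.sum_congr rfl fun x _ => ?_
    by_cases hx : p x = 0
    · simp [hx]
    · rw [if_neg hx, Real.log_div hx (hqpos x hx).ne']
  have h2 : ∑ x, (if p x = 0 then δ else p x / q x) * q x ≤ ∑ x, (p x + δ * q x) := by
    refine Finset.sum_le_sum fun x _ => ?_
    by_cases hx : p x = 0
    · simp [hx]
    · rw [if_neg hx, div_mul_cancel₀ _ (hqpos x hx).ne']
      have := mul_nonneg hδ0.le (hq x)
      linarith
  rw [Finset.sum_add_distrib, hp1, ← Finset.mul_sum] at h2
  have h3 : δ * ∑ x, q x ≤ ε := by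
    rw [hδ, div_mul_eq_mul_div, div_le_iff₀ (by positivity)]
    nlinarith
  simp only [h1] at hy
  linarith

/-- Tests H = ∑ y_x M_x reduce the hypothesis to the outcome distributions, since ∑ (log y_x) M_x ≤
log H by operator Jensen. -/
lemma measuredRelEntropy_le {ρ ω : Matrix a a ℂ} (hρ : IsDensity ρ) (hω : 0 ≤ ω) {c : ℝ}
    (h : ∀ H : Matrix a a ℂ, H.PosDef → retr (ρ * opLog H) - c + 1 ≤ retr (H * ω)) :
    measuredRelEntropy ρ ω ≤ (c : EReal) := by
  refine iSup_le fun n => iSup_le fun M => iSup_le fun hM => ?_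
  rw [measure_eq_diagonal hM hρ.1.1, measure_eq_diagonal hM hω.posSemidef.1]
  have hM0 := hM.nonneg
  obtain ⟨h0, hle⟩ := sum_mul_log_sub_log_le_of_forall (p := fun x => retr (ρ * M x))
    (q := fun x => retr (ω * M x)) (c := c) (fun x => retr_mul_nonneg hρ.1.nonneg (hM0 x)) (by
      rw [← map_sum, ← Finset.mul_sum, hM.2, mul_one, density_retr hρ])
    (fun x => retr_mul_nonneg hω (hM0 x)) (fun y hy => by
      have hy' : (diagonal fun x => (y x : ℂ)).PosDef := by
        rw [posDef_diagonal_iff]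
        exact fun x => by exact_mod_cast hy x
      have hL := povmMap_isPositiveMap hM0
      have hL1 := povmMap_one hM.2
      have h1 := h _ (hL.map_posDef hL1 hy')
      have h2 := retr_mul_le_mul_left hρ.1.nonneg (hL.map_opLog_le hL1 hy')
      rw [opLog, cfc_diagonal, povmMap_diagonal] at h2
      rw [povmMap_diagonal] at h1 h2
      simp only [Finset.mul_sum, Finset.sum_mul, map_sum, mul_smul_comm, smul_mul_assoc, map_smul,
        smul_eq_mul, retr_mul_comm (M _) ω] at h1 h2
      simp only [mul_comm (retr (ρ * _))]
      linarith)
  rw [(relEntropy_diagonal _ _).1 h0]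
  exact_mod_cast hle

/-! ### Measured relative entropy and fidelity -/

/-- Gibbs' inequality is applied to p/y and to qy; adding the two cancels y. -/
lemma neg_two_mul_log_le_sum {ι : Type*} [Fintype ι] {p q y : ι → ℝ} {k : ℝ}
    (hp : ∀ x, 0 ≤ p x) (hp1 : ∑ x, p x = 1) (hq : ∀ x, 0 ≤ q x) (hpq : ∀ x, q x = 0 → p x = 0)
    (hy : ∀ x, 0 < y x) (h1 : ∑ x, p x * (y x)⁻¹ ≤ k) (h2 : ∑ x, q x * y x ≤ k) :
    -2 * Real.log k ≤ ∑ x, p x * (Real.log (p x) - Real.log (q x)) := by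
  have hqpos : ∀ x, 0 < p x → 0 < q x := fun x hx =>
    lt_of_le_of_ne (hq x) fun h' => hx.ne' (hpq x h'.symm)
  obtain ⟨x₀, -, hx₀⟩ : ∃ i ∈ Finset.univ, 0 < p i :=
    Finset.exists_lt_of_sum_lt (by simp [hp1])
  have g1 := sum_mul_log_sub_log_le hp hp1 (z := fun x => p x * (y x)⁻¹)
    (fun x => mul_nonneg (hp x) (inv_pos.2 (hy x)).le) fun x hx => mul_pos hx (inv_pos.2 (hy x))
  have g2 := sum_mul_log_sub_log_le hp hp1 (z := fun x => q x * y x)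
    (fun x => mul_nonneg (hq x) (hy x).le) fun x hx => mul_pos (hqpos x hx) (hy x)
  have l1 := Real.log_le_log (Finset.sum_pos' (fun x _ => mul_nonneg (hp x) (inv_pos.2 (hy x)).le)
    ⟨x₀, Finset.mem_univ _, mul_pos hx₀ (inv_pos.2 (hy x₀))⟩) h1
  have l2 := Real.log_le_log (Finset.sum_pos' (fun x _ => mul_nonneg (hq x) (hy x).le)
    ⟨x₀, Finset.mem_univ _, mul_pos (hqpos x₀ hx₀) (hy x₀)⟩) h2
  have hsum : ∑ x, p x * (Real.log (p x * (y x)⁻¹) - Real.log (p x)) +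
      ∑ x, p x * (Real.log (q x * y x) - Real.log (p x)) =
      -∑ x, p x * (Real.log (p x) - Real.log (q x)) := by
    rw [← Finset.sum_add_distrib, ← Finset.sum_neg_distrib]
    refine Finset.sum_congr rfl fun x _ => ?_
    rcases (hp x).eq_or_lt with h0 | h0
    · simp [← h0]
    · rw [Real.log_mul h0.ne' (inv_pos.2 (hy x)).ne', Real.log_mul (hqpos x h0).ne' (hy x).ne',
        Real.log_inv]
      ring
  linarith

lemma retr_mul_conj_single (U X : Matrix a a ℂ) (i : a) :
    retr (X * (U * Matrix.single i i 1 * Uᴴ)) = ((Uᴴ * X * U) i i).re := by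
  have := retr_mul_conj_diagonal U X (Pi.single i 1)
  have h : (fun j => ((Pi.single i 1 : a → ℝ) j : ℂ)) = Pi.single i 1 := by
    ext j
    by_cases hj : j = i
    · subst hj; simp
    · simp [hj]
  rw [h, diagonal_single] at this
  rw [this, Finset.sum_eq_single i]
  · simp
  · intro j _ hj
    simp [hj]
  · simp

/-- Measuring in an eigenbasis of H turns both traces into classical expectations. Without absolute
continuity of the outcomes the measured entropy is `⊤`. -/
lemma neg_two_mul_log_le_measuredRelEntropy {ρ ω H : Matrix a a ℂ} (hρ : IsDensity ρ) (hω : 0 ≤ ω)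
    (hH : H.PosDef) {k : ℝ} (h1 : retr (ρ * H⁻¹) ≤ k) (h2 : retr (ω * H) ≤ k) :
    ((-2 * Real.log k : ℝ) : EReal) ≤ measuredRelEntropy ρ ω := by
  obtain ⟨U, y, hU, hU', rfl⟩ := hH.1.exists_diagonalization
  have hy := (conj_diagonal_posDef_iff hU y).1 hH
  have hinv : (U * diagonal (fun i => (y i : ℂ)) * Uᴴ)⁻¹ =
      U * diagonal (fun i => (((y i)⁻¹ : ℝ) : ℂ)) * Uᴴ := by
    refine Matrix.inv_eq_right_inv ?_
    calc _ = U * (diagonal (fun i => (y i : ℂ)) * (Uᴴ * U) *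
          diagonal (fun i => (((y i)⁻¹ : ℝ) : ℂ))) * Uᴴ := by simp only [mul_assoc]
      _ = 1 := by
        rw [hU, mul_one, diagonal_mul_diagonal]
        have : (fun i => (y i : ℂ) * (((y i)⁻¹ : ℝ) : ℂ)) = fun _ => 1 := by
          ext i
          rw [← Complex.ofReal_mul, mul_inv_cancel₀ (hy i).ne', Complex.ofReal_one]
        rw [this, diagonal_one, mul_one, hU']
  rw [hinv, retr_mul_conj_diagonal] at h1
  rw [retr_mul_conj_diagonal] at h2
  set e := (Fintype.equivFin a).symm with he
  set M : Fin (Fintype.card a) → Matrix a a ℂ :=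
    fun x => U * Matrix.single (e x) (e x) 1 * Uᴴ with hMdef
  have hM : IsProjMeasurement M := by
    refine ⟨fun x => ⟨?_, ?_⟩, ?_⟩
    · rw [IsHermitian, hMdef]
      simp [conjTranspose_mul, mul_assoc]
    · calc M x * M x = U * (Matrix.single (e x) (e x) 1 * (Uᴴ * U) *
            Matrix.single (e x) (e x) 1) * Uᴴ := by simp only [hMdef, mul_assoc]
        _ = M x := by simp [hU, hMdef]
    · simp only [hMdef]
      rw [← Finset.sum_mul, ← Finset.mul_sum, e.sum_comp fun i => Matrix.single i i (1 : ℂ)]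
      have : ∑ i : a, Matrix.single i i (1 : ℂ) = 1 := by
        have := sum_single_eq_diagonal (fun _ : a => (1 : ℂ))
        rw [this, diagonal_one]
      rw [this, mul_one, hU']
  refine le_trans ?_ (le_iSup_of_le _ (le_iSup_of_le M (le_iSup_of_le hM le_rfl)))
  rw [measure_eq_diagonal hM hρ.1.1, measure_eq_diagonal hM hω.posSemidef.1]
  by_cases h0 : ∀ x, retr (ω * M x) = 0 → retr (ρ * M x) = 0
  · rw [(relEntropy_diagonal _ _).1 h0, EReal.coe_le_coe_iff]
    have hM0 := hM.nonneg
    refine neg_two_mul_log_le_sum (y := fun x => y (e x))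
      (fun x => retr_mul_nonneg hρ.1.nonneg (hM0 x)) ?_
      (fun x => retr_mul_nonneg hω (hM0 x)) h0 (fun x => hy _) ?_ ?_
    · rw [← map_sum, ← Finset.mul_sum, hM.2, mul_one, density_retr hρ]
    · simp only [hMdef, retr_mul_conj_single]
      rwa [e.sum_comp fun i => ((Uᴴ * ρ * U) i i).re * (y i)⁻¹]
    · simp only [hMdef, retr_mul_conj_single]
      rwa [e.sum_comp fun i => ((Uᴴ * ω * U) i i).re * y i]
  · rw [(relEntropy_diagonal _ _).2 h0]
    exact le_top

/-- `tr √(√ω ρ √ω)`. -/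
noncomputable def sqrtFidelity (ρ ω : Matrix a a ℂ) : ℝ := retr (opSqrt (opSqrt ω * ρ * opSqrt ω))

lemma fidelity_eq {ρ : Matrix a a ℂ} (hρ : 0 ≤ ρ) (ω : Matrix a a ℂ) :
    fidelity ρ ω = sqrtFidelity ρ ω := by
  rw [fidelity, traceNorm, sqrtFidelity, retr_apply, conjTranspose_mul, (opSqrt_isHermitian ρ).eq,
    (opSqrt_isHermitian ω).eq, mul_assoc, ← mul_assoc (opSqrt ρ), opSqrt_mul_self hρ, ← mul_assoc]

lemma sqrtFidelity_nonneg (ρ ω : Matrix a a ℂ) : 0 ≤ sqrtFidelity ρ ω :=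
  retr_nonneg (opSqrt_nonneg _)

lemma opSqrt_isUnit {X : Matrix a a ℂ} (hX : X.PosDef) : IsUnit (opSqrt X) := by
  refine isUnit_of_posDef_mul_self ?_
  rwa [opSqrt_mul_self hX.posSemidef.nonneg]

lemma opSqrt_posDef {X : Matrix a a ℂ} (hX : X.PosDef) : (opSqrt X).PosDef :=
  ((opSqrt_nonneg X).posSemidef.posDef_iff_isUnit).2 (opSqrt_isUnit hX)

/-- The Fuchs–Caves operator H = B⁻¹KB⁻¹, with B = √ω' and K = √(Bρ'B), makes tr ρ'H⁻¹ and tr ω'H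
both equal to tr K. The primed operators supply invertibility; passing down to ρ and ω only lowers
these traces. -/
lemma sqrtFidelity_bound {ρ ω ρ' ω' : Matrix a a ℂ} (hρ : IsDensity ρ) (hω : 0 ≤ ω)
    (hρ' : ρ'.PosDef) (hω' : ω'.PosDef) (hρρ' : ρ ≤ ρ') (hωω' : ω ≤ ω') :
    ((-2 * Real.log (sqrtFidelity ρ' ω') : ℝ) : EReal) ≤ measuredRelEntropy ρ ω := by
  set B := opSqrt ω' with hB
  have hBH : Bᴴ = B := opSqrt_isHermitian ω'
  have hBu : IsUnit B := opSqrt_isUnit hω'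
  have hBB : B * B = ω' := opSqrt_mul_self hω'.posSemidef.nonneg
  have hG : (B * ρ' * B).PosDef := by
    have := hρ'.conj_isUnit hBu
    rwa [hBH] at this
  set K := opSqrt (B * ρ' * B) with hK
  have hKp : K.PosDef := opSqrt_posDef hG
  have hKK : K * K = B * ρ' * B := opSqrt_mul_self hG.posSemidef.nonneg
  have hBd : IsUnit B.det := (isUnit_iff_isUnit_det B).1 hBu
  have hKd : IsUnit K.det := (isUnit_iff_isUnit_det K).1 hKp.isUnit
  have hBi : B * B⁻¹ = 1 := mul_nonsing_inv B hBd
  have hBi' : B⁻¹ * B = 1 := nonsing_inv_mul B hBd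
  have hKi : K * K⁻¹ = 1 := mul_nonsing_inv K hKd
  have hBiH : (B⁻¹)ᴴ = B⁻¹ := by rw [conjTranspose_nonsing_inv, hBH]
  set H := B⁻¹ * K * B⁻¹ with hH
  have hHp : H.PosDef := by
    have := hKp.conj_isUnit (A := B⁻¹) (IsUnit.of_mul_eq_one B hBi')
    rwa [hBiH] at this
  have hHinv : H⁻¹ = B * K⁻¹ * B := by
    refine Matrix.inv_eq_right_inv ?_
    calc H * (B * K⁻¹ * B) = B⁻¹ * (K * (B⁻¹ * B) * K⁻¹) * B := by simp only [hH, mul_assoc]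
      _ = 1 := by rw [hBi', mul_one, hKi, mul_one, hBi']
  refine neg_two_mul_log_le_measuredRelEntropy hρ hω hHp ?_ ?_
  · refine (retr_mul_le_mul_right hHp.inv.posSemidef.nonneg hρρ').trans (le_of_eq ?_)
    rw [hHinv]
    calc retr (ρ' * (B * K⁻¹ * B)) = retr ((ρ' * B * K⁻¹) * B) := by simp only [mul_assoc]
      _ = retr (B * ρ' * B * K⁻¹) := by rw [retr_mul_comm]; simp only [mul_assoc]
      _ = retr K := by rw [← hKK, mul_assoc, hKi, mul_one]
  · refine (retr_mul_le_mul_right hHp.posSemidef.nonneg hωω').trans (le_of_eq ?_)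
    calc retr (ω' * H) = retr (B * (B * B⁻¹) * K * B⁻¹) := by
          rw [← hBB, hH]; simp only [mul_assoc]
      _ = retr (B * K * B⁻¹) := by rw [hBi, mul_one]
      _ = retr K := by rw [retr_mul_comm, ← mul_assoc, hBi', one_mul]

open Filter Topology in
lemma tendsto_sqrtFidelity {ρ ω : Matrix a a ℂ} (hρ : 0 ≤ ρ) (hω : 0 ≤ ω) :
    Tendsto (fun ε : ℝ => sqrtFidelity (ρ + ε • (1 : Matrix a a ℂ)) (ω + ε • (1 : Matrix a a ℂ)))
      (𝓝[>] 0) (𝓝 (sqrtFidelity ρ ω)) := by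
  have hpert {X : Matrix a a ℂ} : Tendsto (fun ε : ℝ => X + ε • (1 : Matrix a a ℂ)) (𝓝[>] 0)
      (𝓝 X) := by
    have h : Continuous fun ε : ℝ => X + ε • (1 : Matrix a a ℂ) := by fun_prop
    simpa using (h.tendsto 0).mono_left (nhdsWithin_le_nhds (s := Set.Ioi 0))
  have hpert0 {X : Matrix a a ℂ} (hX : 0 ≤ X) : ∀ ε ∈ Set.Ioi (0 : ℝ),
      0 ≤ X + ε • (1 : Matrix a a ℂ) := fun ε hε =>
    add_nonneg hX (smul_nonneg (le_of_lt hε) zero_le_one)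
  have hsqrt {F : ℝ → Matrix a a ℂ} {X : Matrix a a ℂ} (hX : 0 ≤ X) (hF : Tendsto F (𝓝[>] 0) (𝓝 X))
      (hF0 : ∀ ε ∈ Set.Ioi (0 : ℝ), 0 ≤ F ε) :
      Tendsto (fun ε => opSqrt (F ε)) (𝓝[>] 0) (𝓝 (opSqrt X)) := by
    have h1 := (CFC.continuousOn_sqrt (A := Matrix a a ℂ)) X hX
    have h2 : Tendsto F (𝓝[>] 0) (𝓝[{x | 0 ≤ x}] X) :=
      tendsto_nhdsWithin_iff.2 ⟨hF, eventually_of_mem self_mem_nhdsWithin hF0⟩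
    rw [opSqrt_eq_sqrt hX]
    refine (h1.tendsto.comp h2).congr' (eventually_of_mem self_mem_nhdsWithin fun ε hε => ?_)
    exact (opSqrt_eq_sqrt (hF0 ε hε)).symm
  have hconj {X Y : Matrix a a ℂ} (hX : 0 ≤ X) : 0 ≤ opSqrt Y * X * opSqrt Y := by
    have := conj_nonneg hX (opSqrt Y)
    rwa [(opSqrt_isHermitian Y).eq] at this
  have h1 := hsqrt hω hpert (hpert0 hω)
  have h2 := hsqrt (hconj (Y := ω) hρ) ((h1.mul (hpert (X := ρ))).mul h1)
    fun ε hε => hconj (hpert0 hρ ε hε)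
  exact ((retr (a := a)).continuous_of_finiteDimensional.tendsto _).comp h2

open Filter Topology in
lemma neg_two_mul_log_fidelity_le {ρ ω : Matrix a a ℂ} (hρ : IsDensity ρ) (hω : 0 ≤ ω) :
    (-2 : EReal) * ENNReal.log (ENNReal.ofReal (fidelity ρ ω)) ≤ measuredRelEntropy ρ ω := by
  have hbound : ∀ ε ∈ Set.Ioi (0 : ℝ), ((-2 * Real.log (sqrtFidelity (ρ + ε • (1 : Matrix a a ℂ))
      (ω + ε • (1 : Matrix a a ℂ))) : ℝ) : EReal) ≤ measuredRelEntropy ρ ω := by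
    intro ε hε
    have hε1 := posDef_smul_one (a := a) hε
    exact sqrtFidelity_bound hρ hω (PosDef.posSemidef_add hρ.1 hε1)
      (PosDef.posSemidef_add hω.posSemidef hε1) (le_add_of_nonneg_right hε1.posSemidef.nonneg)
      (le_add_of_nonneg_right hε1.posSemidef.nonneg)
  have htend := tendsto_sqrtFidelity hρ.1.nonneg hω
  rw [fidelity_eq hρ.1.nonneg]
  rcases (sqrtFidelity_nonneg ρ ω).eq_or_lt with h0 | h0
  -- At zero fidelity the perturbed bounds diverge, so the measured entropy exceeds every real y;
  -- the threshold exp(−(y + 1)/2) makes −2 log larger than y + 1.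
  · have htop : measuredRelEntropy ρ ω = ⊤ := by
      rw [EReal.eq_top_iff_forall_lt]
      intro y
      have hpos : ∀ ε ∈ Set.Ioi (0 : ℝ), 0 < sqrtFidelity (ρ + ε • (1 : Matrix a a ℂ))
          (ω + ε • (1 : Matrix a a ℂ)) := by
        intro ε hε
        have hε1 := posDef_smul_one (a := a) hε
        have h1 := PosDef.posSemidef_add hρ.1 hε1
        have h2 := opSqrt_isUnit (PosDef.posSemidef_add hω.posSemidef hε1)
        have h3 := h1.conj_isUnit h2
        rw [(opSqrt_isHermitian _).eq] at h3
        have h4 := opSqrt_posDef h3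
        have hne : Nonempty a := by
          by_contra h
          rw [not_nonempty_iff] at h
          have := hρ.2
          rw [Subsingleton.elim ρ 0] at this
          simp at this
        exact (Complex.lt_def.1 h4.trace_pos).1
      have h1 : ∀ᶠ ε in 𝓝[>] (0 : ℝ), sqrtFidelity (ρ + ε • (1 : Matrix a a ℂ))
          (ω + ε • (1 : Matrix a a ℂ)) < Real.exp (-(y + 1) / 2) := by
        rw [← h0] at htend
        exact htend.eventually (gt_mem_nhds (Real.exp_pos _))
      obtain ⟨ε, hε1, hε⟩ := (h1.and self_mem_nhdsWithin).exists
      refine lt_of_lt_of_le ?_ (hbound ε hε)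
      rw [EReal.coe_lt_coe_iff]
      have h2 := (Real.log_lt_iff_lt_exp (hpos ε hε)).2 hε1
      linarith
    rw [htop]
    exact le_top
  · have h1 : (-2 : EReal) * ENNReal.log (ENNReal.ofReal (sqrtFidelity ρ ω)) =
        ((-2 * Real.log (sqrtFidelity ρ ω) : ℝ) : EReal) := by
      rw [ENNReal.log_ofReal_of_pos h0, EReal.coe_mul]
      rfl
    rw [h1]
    have h2 : Tendsto (fun ε : ℝ => ((-2 * Real.log (sqrtFidelity (ρ + ε • (1 : Matrix a a ℂ))
      (ω + ε • (1 : Matrix a a ℂ))) : ℝ) : EReal)) (𝓝[>] 0)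
        (𝓝 ((-2 * Real.log (sqrtFidelity ρ ω) : ℝ) : EReal)) :=
      (continuous_coe_real_ereal.tendsto _).comp
        (((Real.continuousAt_log h0.ne').tendsto.comp htend).const_mul (-2))
    exact le_of_tendsto h2 (eventually_of_mem self_mem_nhdsWithin hbound)

end PetzRecovery
end

theorem theorem1 {a b : Type*} [Fintype a] [DecidableEq a] [Fintype b] [DecidableEq b]
    (σ ρ : Matrix a a ℂ) (hσ : σ.PosSemidef) (hρ : IsDensity ρ) (hsupp : supp ρ ≤ supp σ)
    (N : Matrix a a ℂ →ₗ[ℂ] Matrix b b ℂ) (hTP : IsTracePreserving N)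
    (hN : IsTensorStablePositive N) :
    ∃ R ∈ rotatedPetzHull σ N,
      relEntropy ρ σ - relEntropy (N ρ) (N σ) ≥ measuredRelEntropy ρ (R (N ρ)) ∧
      measuredRelEntropy ρ (R (N ρ)) ≥
        (-2 : EReal) * ENNReal.log (ENNReal.ofReal (fidelity ρ (R (N ρ)))) ∧
      R (N σ) = σ := by
  have hN1 := hN.isPositiveMap
  have hker := kerProj_mul_of_supp_le hσ.1 hsupp
  have hker' := kerProj_map hN1 hσ.nonneg hρ.1.nonneg hker
  obtain ⟨R, hR, hbound⟩ := exists_mem_rotatedPetzHull hTP hN hσ.nonneg hρ hker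
  have hω := map_nonneg_of_mem_rotatedPetzHull hN1 hR (hN1.map_nonneg hρ.1.nonneg)
  refine ⟨R, hR, ?_, neg_two_mul_log_fidelity_le hρ hω,
    apply_self_of_mem_rotatedPetzHull hTP hN1 hσ.nonneg hR⟩
  -- Both support inclusions hold, so the difference in `EReal` is one of real numbers.
  rw [relEntropy, relEntropy, if_pos hsupp, if_pos ((supp_le_iff (hN1 σ hσ).1).2 hker'),
    ← EReal.coe_sub]
  exact measuredRelEntropy_le hρ hω hbound
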